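/- Let $k$ be a field of characteristic zero and let $(\mathcal L,[\cdot,\cdot],\triangleright)$ be a post-Lie algebra over $k$, i.e. a Lie algebra with a bilinear product satisfying $x\triangleright[y,z]=[x\triangleright y,z]+[y,x\triangleright z]$ and $[x,y]\triangleright z=a(x,y,z)-a(y,x,z)$, where $a(x,y,z)=x\triangleright(y\triangleright z)-(x\triangleright y)\triangleright z$. Let $\mathcal U=\mathcal U(\mathcal L)$ be the universal enveloping algebra of $(\mathcal L,[\cdot,\cdot])$, with coproduct $\Delta(x)=x\otimes 1+1\otimes x$ for $x\in\mathcal L$ (extended multiplicatively, $\Delta(A)=A_{(1)}\otimes A_{(2)}$), and extend $\triangleright$ to $\mathcal U$ by $1\triangleright A=A$, $xA\triangleright y=x\triangleright(A\triangleright y)-(x\triangleright A)\triangleright y$ for $x,y\in\mathcal L$, and $A\triangleright BC=(A_{(1)}\triangleright B)(A_{(2)}\triangleright C)$. Put $A*B=A_{(1)}(A_{(2)}\triangleright B)$. Extend all operations $h$-linearly to the formal power series $\mathcal U[[h]]$. For $\alpha\in\mathcal U[[h]]$ without constant term let $\exp(\alpha)=\sum_{j\ge0}\frac1{j!}\alpha^j$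 and $\exp^*(\alpha)=\sum_{j\ge0}\frac1{j!}\alpha^{*j}$ be the exponentials for the concatenation product and for $*$; $\alpha$ is an infinitesimal character if moreover $\Delta(\alpha)=\alpha\otimes1+1\otimes\alpha$. Let $$d\exp^{-1}_U(V)=\sum_{k\ge0}\frac{B_k}{k!}\operatorname{ad}_U^{k}(V)=V+\tfrac12[U,V]+\tfrac1{12}[U,[U,V]]+\cdots ,$$ with the Bernoulli numbers $B_k$ normalized by $B_1=+\frac12$. Let $a_{ij},b_j\in k$ $(1\le i,j\le s)$ satisfy the classical Runge--Kutta order conditions up to order $p$: for every rooted tree $\tau$ with $|\tau|\le p$ vertices, $\sum_i b_i\Phi_i(\tau)=1/\tau!$, where for $\tau=B^+(\tau_1\cdots\tau_n)$ (the tree obtained by joining $\tau_1,\dots,\tau_n$ to a new root) $\Phi_i(\tau)=\prod_{m=1}^n\sum_j a_{ij}\Phi_j(\tau_m)$ and $\tau!=|\tau|\,\tau_1!\cdots\tau_n!$ (empty products being $1$). Theorem (RKMK order). Let $f\in\mathcal L$. The stage equations of the RKMK method applied to $hf$, $$U_i=\sum_j a_{ij}K_j,\qquad K_i=d\exp^{-1}_{U_i}\bigl(\exp(U_i)\triangleright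 hf\bigr),\qquad i=1,\dots,s,$$ have exactly one solution $(K_1,\dots,K_s)$ in infinitesimal characters of $\mathcal U[[h]]$, and $\Psi_{\mathrm{RKMK}}(hf):=\exp\bigl(\sum_i b_iK_i\bigr)$ satisfies $$\Psi_{\mathrm{RKMK}}(hf)-\exp^*(hf)=\mathcal O(h^{p+1}),$$ i.e. the difference is divisible by $h^{p+1}$ in $\mathcal U[[h]]$. The same holds if the series of $d\exp^{-1}$ is truncated to its terms with $k\le N$, for any $N\ge p-1$. -/

import Mathlib

open scoped TensorProduct PowerSeries

/-- A post-Lie algebra structure on a Lie algebra `L` over `k`: a bilinear product `▷`, written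
`tr x y`, that acts by derivations of the bracket and satisfies
`[x, y] ▷ z = a(x, y, z) - a(y, x, z)` for the associator
`a(x, y, z) = x ▷ (y ▷ z) - (x ▷ y) ▷ z`. -/
structure PostLieAlgebra (k L : Type*) [Field k] [LieRing L] [LieAlgebra k L] where
  tr : L →ₗ[k] L →ₗ[k] L
  tr_lie : ∀ x y z : L, tr x ⁅y, z⁆ = ⁅tr x y, z⁆ + ⁅y, tr x z⁆
  lie_tr : ∀ x y z : L, tr ⁅x, y⁆ z =
    (tr x (tr y z) - tr (tr x y) z) - (tr y (tr x z) - tr (tr y x) z)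

namespace PostLieAlgebra

section Extension

attribute [local instance 100] LieRing.ofAssociativeRing

variable {k L : Type*} [Field k] [LieRing L] [LieAlgebra k L]

local notation "𝓤" => UniversalEnvelopingAlgebra k L
local notation "ι" => UniversalEnvelopingAlgebra.ι k

/-- Monomials `x₁ ⋯ xₙ` span the enveloping algebra. -/
theorem env_induction {C : UniversalEnvelopingAlgebra k L → Prop} (h1 : C 1)
    (hmul : ∀ (x : L) (A : UniversalEnvelopingAlgebra k L), C A → C (ι x * A))
    (hadd : ∀ A B, C A → C B → C (A + B)) (hsmul : ∀ (c : k) A, C A → C (c • A))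
    (A : UniversalEnvelopingAlgebra k L) : C A := by
  let S : Subalgebra k 𝓤 := Algebra.adjoin k (Set.range (ι : L → 𝓤))
  have hS : ∀ x : L, ι x ∈ S := fun x => Algebra.subset_adjoin ⟨x, rfl⟩
  let g : L →ₗ⁅k⁆ S :=
    { toFun := fun x => ⟨ι x, hS x⟩
      map_add' := fun x y => by ext; simp
      map_smul' := fun c x => by ext; simp
      map_lie' := fun {x y} => by
        ext
        simp [LieRing.of_associative_ring_bracket] }
  have hg : S.val.comp (UniversalEnvelopingAlgebra.lift k g) = AlgHom.id k 𝓤 := by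
    apply UniversalEnvelopingAlgebra.hom_ext
    ext x
    change S.val (UniversalEnvelopingAlgebra.lift k g (ι x)) = ι x
    rw [UniversalEnvelopingAlgebra.lift_ι_apply]
    rfl
  have hA : A ∈ S := by
    have := congrArg (fun F : 𝓤 →ₐ[k] 𝓤 => F A) hg
    simp only [AlgHom.coe_comp, Function.comp_apply, AlgHom.coe_id, id_eq] at this
    rw [← this]
    exact (UniversalEnvelopingAlgebra.lift k g A).2
  have key : ∀ B : 𝓤, C B → C (A * B) := by
    refine Algebra.adjoin_induction (p := fun A _ => ∀ B : 𝓤, C B → C (A * B)) ?_ ?_ ?_ ?_ hA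
    · rintro _ ⟨x, rfl⟩ B hB
      exact hmul x B hB
    · intro c B hB
      rw [← Algebra.smul_def]
      exact hsmul c B hB
    · intro A₁ A₂ _ _ h₁ h₂ B hB
      rw [add_mul]
      exact hadd _ _ (h₁ B hB) (h₂ B hB)
    · intro A₁ A₂ _ _ h₁ h₂ B hB
      rw [mul_assoc]
      exact h₁ _ (h₂ B hB)
  simpa using key 1 h1

variable (P : PostLieAlgebra k L)

/-- The second Lie bracket `⟦x, y⟧ = x ▷ y - y ▷ x + [x, y]`. -/
def dbl (x y : L) : L := P.tr x y - P.tr y x + ⁅x, y⁆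

theorem dbl_tr (x y z : L) : P.tr (P.dbl x y) z = P.tr x (P.tr y z) - P.tr y (P.tr x z) := by
  simp only [dbl, map_add, map_sub, LinearMap.add_apply, LinearMap.sub_apply, P.lie_tr]
  abel

/-- The algebra map `u ↦ u + ε (x ▷ u)` into the dual numbers over the enveloping algebra. -/
noncomputable def derDual (x : L) :
    UniversalEnvelopingAlgebra k L →ₐ[k]
      TrivSqZeroExt (UniversalEnvelopingAlgebra k L) (UniversalEnvelopingAlgebra k L) :=
  UniversalEnvelopingAlgebra.lift k
    { toFun := fun y => TrivSqZeroExt.inl (ι y) + TrivSqZeroExt.inr (ι (P.tr x y))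
      map_add' := fun y z => by ext <;> simp
      map_smul' := fun c y => by ext <;> simp
      map_lie' := fun {y z} => by
        ext
        · simp [LieRing.of_associative_ring_bracket]
        · simp only [LieHom.map_lie, LieRing.of_associative_ring_bracket, P.tr_lie, map_add,
            TrivSqZeroExt.snd_add, TrivSqZeroExt.snd_sub, TrivSqZeroExt.snd_mul,
            TrivSqZeroExt.fst_add, TrivSqZeroExt.fst_inl, TrivSqZeroExt.fst_inr,
            TrivSqZeroExt.snd_inl, TrivSqZeroExt.snd_inr, add_zero, zero_add, smul_eq_mul,
            MulOpposite.smul_eq_mul_unop, MulOpposite.unop_op]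
          abel }

theorem derDual_ι (x y : L) : P.derDual x (ι y) =
    TrivSqZeroExt.inl (ι y) + TrivSqZeroExt.inr (ι (P.tr x y)) := by
  rw [derDual, UniversalEnvelopingAlgebra.lift_ι_apply]
  rfl

theorem fst_derDual (x : L) (A : UniversalEnvelopingAlgebra k L) :
    (P.derDual x A).fst = A := by
  induction A using env_induction with
  | h1 => simp
  | hmul y A h => rw [map_mul, TrivSqZeroExt.fst_mul, h, derDual_ι]; simp
  | hadd A B hA hB => simp [hA, hB]
  | hsmul c A hA => simp [hA]

theorem snd_derDual_mul (x : L) (A B : UniversalEnvelopingAlgebra k L) :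
    (P.derDual x (A * B)).snd = (P.derDual x A).snd * B + A * (P.derDual x B).snd := by
  rw [map_mul, TrivSqZeroExt.snd_mul, fst_derDual, fst_derDual]
  simp [add_comm]

/-- The derivation `A ↦ x ▷ A` of the enveloping algebra, for `x ∈ L`:
`x ▷ (t₁ ⋯ tₙ) = ∑ i, t₁ ⋯ (x ▷ tᵢ) ⋯ tₙ`. -/
noncomputable def der :
    L →ₗ[k] UniversalEnvelopingAlgebra k L →ₗ[k] UniversalEnvelopingAlgebra k L :=
  LinearMap.mk₂ k (fun x A => (P.derDual x A).snd)
    (fun x y A => by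
      induction A using env_induction with
      | h1 => simp
      | hmul z A h => simp only [snd_derDual_mul, h, derDual_ι]; simp; noncomm_ring
      | hadd A B hA hB => simp only [map_add, TrivSqZeroExt.snd_add, hA, hB]; abel
      | hsmul c A hA => simp [hA])
    (fun c x A => by
      induction A using env_induction with
      | h1 => simp
      | hmul z A h => simp only [snd_derDual_mul, h, derDual_ι]; simp
      | hadd A B hA hB => simp only [map_add, TrivSqZeroExt.snd_add, hA, hB, smul_add]
      | hsmul d A hA => simp [hA, smul_comm c d])
    (fun x A B => by simp)
    (fun c x A => by simp)

@[simp] theorem der_one (x : L) : P.der x 1 = 0 := by simp [der]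

@[simp] theorem der_ι (x y : L) : P.der x (ι y) = ι (P.tr x y) := by
  simp only [der, LinearMap.mk₂_apply, derDual_ι]
  simp

theorem der_mul (x : L) (A B : UniversalEnvelopingAlgebra k L) :
    P.der x (A * B) = P.der x A * B + A * P.der x B :=
  P.snd_derDual_mul x A B

theorem der_dbl (x y : L) (A : UniversalEnvelopingAlgebra k L) :
    P.der (P.dbl x y) A = P.der x (P.der y A) - P.der y (P.der x A) := by
  induction A using env_induction with
  | h1 => simp
  | hmul z A h =>
    simp only [der_mul, der_ι, dbl_tr, h, map_add, map_sub]
    noncomm_ring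
  | hadd A B hA hB => simp only [map_add, hA, hB]; abel
  | hsmul c A hA => simp only [map_smul, hA, smul_sub]

/-- Auxiliary space for the extension of `▷` to all of `𝓤(L)`. An element `A` of `𝓤(L)` and a
vector `v` will be recorded through the function
`[y₁, …, yₙ] ↦ (yₙ ▷ ⋯ (y₁ ▷ A)) ▷ v`. -/
def orbitSpace : Submodule k (List L → UniversalEnvelopingAlgebra k L) where
  carrier := {φ |
    (∀ l m x y, φ (l ++ (x + y) :: m) = φ (l ++ x :: m) + φ (l ++ y :: m)) ∧
    (∀ l m (c : k) x, φ (l ++ (c • x) :: m) = c • φ (l ++ x :: m)) ∧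
    (∀ l m x y, φ (l ++ x :: y :: m) - φ (l ++ y :: x :: m) = - φ (l ++ P.dbl x y :: m))}
  zero_mem' := by simp
  add_mem' := by
    rintro φ ψ ⟨h1, h2, h3⟩ ⟨g1, g2, g3⟩
    refine ⟨fun l m x y => ?_, fun l m c x => ?_, fun l m x y => ?_⟩
    · simp only [Pi.add_apply, h1, g1]; abel
    · simp only [Pi.add_apply, h2, g2, smul_add]
    · simp only [Pi.add_apply, neg_add, ← h3, ← g3]; abel
  smul_mem' := by
    rintro c φ ⟨h1, h2, h3⟩
    refine ⟨fun l m x y => ?_, fun l m d x => ?_, fun l m x y => ?_⟩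
    · simp only [Pi.smul_apply, h1, smul_add]
    · simp only [Pi.smul_apply, h2, smul_comm c d]
    · simp only [Pi.smul_apply, ← smul_sub, h3, smul_neg]

/-- Passing from the record of `A` to the record of `y ▷ A`. -/
def shift (y : L) : P.orbitSpace →ₗ[k] P.orbitSpace where
  toFun φ := ⟨fun m => φ.1 (y :: m),
    fun l m => φ.2.1 (y :: l) m, fun l m => φ.2.2.1 (y :: l) m, fun l m => φ.2.2.2 (y :: l) m⟩
  map_add' _ _ := rfl
  map_smul' _ _ := rfl

/-- Passing from the record of `A` to the record of `x A`, dictated by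
`x A ▷ v = x ▷ (A ▷ v) - (x ▷ A) ▷ v` and `y ▷ x A = (y ▷ x) A + x (y ▷ A)`. -/
noncomputable def thetaFun : List L → L → (List L → UniversalEnvelopingAlgebra k L) →
    UniversalEnvelopingAlgebra k L
  | [], x, φ => P.der x (φ []) - φ [x]
  | y :: l, x, φ => thetaFun l (P.tr y x) φ + thetaFun l x (fun m => φ (y :: m))

theorem thetaFun_add (l : List L) (x : L) (φ ψ : List L → UniversalEnvelopingAlgebra k L) :
    P.thetaFun l x (φ + ψ) = P.thetaFun l x φ + P.thetaFun l x ψ := by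
  induction l generalizing x φ ψ with
  | nil => simp [thetaFun]; abel
  | cons y l ih =>
    simp only [thetaFun, ih]
    have := ih x (fun m => φ (y :: m)) (fun m => ψ (y :: m))
    have e : (fun m => (φ + ψ) (y :: m)) = (fun m => φ (y :: m)) + (fun m => ψ (y :: m)) := rfl
    rw [e, this]; abel

theorem thetaFun_smul (l : List L) (x : L) (c : k)
    (φ : List L → UniversalEnvelopingAlgebra k L) :
    P.thetaFun l x (c • φ) = c • P.thetaFun l x φ := by
  induction l generalizing x φ with
  | nil => simp [thetaFun, smul_sub]
  | cons y l ih =>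
    simp only [thetaFun, ih, smul_add]
    have e : (fun m => (c • φ) (y :: m)) = c • (fun m => φ (y :: m)) := rfl
    rw [e, ih]

theorem thetaFun_add_left (l : List L) (x y : L) (φ : P.orbitSpace) :
    P.thetaFun l (x + y) φ.1 = P.thetaFun l x φ.1 + P.thetaFun l y φ.1 := by
  induction l generalizing x y φ with
  | nil =>
    have := φ.2.1 [] [] x y
    simp only [List.nil_append] at this
    simp only [thetaFun, map_add, LinearMap.add_apply, this]; abel
  | cons z l ih =>
    simp only [thetaFun, map_add, ih]
    have := ih x y (P.shift z φ)
    simp only [shift, LinearMap.coe_mk, AddHom.coe_mk] at this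
    rw [this]; abel

theorem thetaFun_smul_left (l : List L) (c : k) (x : L) (φ : P.orbitSpace) :
    P.thetaFun l (c • x) φ.1 = c • P.thetaFun l x φ.1 := by
  induction l generalizing x φ with
  | nil =>
    have := φ.2.2.1 [] [] c x
    simp only [List.nil_append] at this
    simp only [thetaFun, map_smul, LinearMap.smul_apply, this, smul_sub]
  | cons z l ih =>
    simp only [thetaFun, map_smul, ih, smul_add]
    have := ih x (P.shift z φ)
    simp only [shift, LinearMap.coe_mk, AddHom.coe_mk] at this
    rw [this]

theorem thetaFun_mem (x : L) (φ : P.orbitSpace) :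
    (fun l => P.thetaFun l x φ.1) ∈ P.orbitSpace := by
  refine ⟨fun l m y z => ?_, fun l m c y => ?_, fun l m y z => ?_⟩
  · induction l generalizing x φ with
    | nil =>
      have h1 := P.thetaFun_add_left m (P.tr y x) (P.tr z x) φ
      have e : (fun n => φ.1 ((y + z) :: n)) = (fun n => φ.1 (y :: n)) + fun n => φ.1 (z :: n) :=
        funext fun n => φ.2.1 [] n y z
      simp only [List.nil_append, thetaFun, map_add, LinearMap.add_apply, h1, e, thetaFun_add]
      abel
    | cons w l ih =>
      simp only [List.cons_append, thetaFun]
      have h1 := ih (P.tr w x) φ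
      have h2 := ih x (P.shift w φ)
      simp only [shift, LinearMap.coe_mk, AddHom.coe_mk] at h1 h2
      rw [h1, h2]; abel
  · induction l generalizing x φ with
    | nil =>
      have h1 := P.thetaFun_smul_left m c (P.tr y x) φ
      have e : (fun n => φ.1 ((c • y) :: n)) = c • (fun n => φ.1 (y :: n)) :=
        funext fun n => φ.2.2.1 [] n c y
      simp only [List.nil_append, thetaFun, map_smul, LinearMap.smul_apply, h1, e, thetaFun_smul,
        smul_add]
    | cons w l ih =>
      simp only [List.cons_append, thetaFun]
      have h1 := ih (P.tr w x) φ
      have h2 := ih x (P.shift w φ)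
      simp only [shift, LinearMap.coe_mk, AddHom.coe_mk] at h1 h2
      rw [h1, h2, smul_add]
  · induction l generalizing x φ with
    | nil =>
      have h1 := P.thetaFun_add_left m (P.tr z (P.tr y x)) (P.tr (P.dbl y z) x) φ
      have e0 : P.tr z (P.tr y x) + P.tr (P.dbl y z) x = P.tr y (P.tr z x) := by
        rw [dbl_tr]; abel
      rw [e0] at h1
      have e : (fun n => φ.1 (y :: z :: n)) + (fun n => φ.1 (P.dbl y z :: n))
          = (fun n => φ.1 (z :: y :: n)) := funext fun n => by
        have := φ.2.2.2 [] n y z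
        simp only [List.nil_append] at this
        simp only [Pi.add_apply]
        rw [← neg_eq_iff_eq_neg] at this
        rw [← this]; abel
      have h2 := P.thetaFun_add m x (fun n => φ.1 (y :: z :: n)) (fun n => φ.1 (P.dbl y z :: n))
      rw [e] at h2
      simp only [List.nil_append, thetaFun, h1, h2]
      abel
    | cons w l ih =>
      simp only [List.cons_append, thetaFun]
      have h1 := ih (P.tr w x) φ
      have h2 := ih x (P.shift w φ)
      simp only [shift, LinearMap.coe_mk, AddHom.coe_mk] at h1 h2
      rw [neg_add, ← h1, ← h2]; abel

/-- `thetaFun` as an operator on the auxiliary space. -/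
noncomputable def theta : L →ₗ[k] Module.End k P.orbitSpace :=
  LinearMap.mk₂ k (fun x φ => ⟨fun l => P.thetaFun l x φ.1, P.thetaFun_mem x φ⟩)
    (fun x y φ => Subtype.ext <| funext fun l => P.thetaFun_add_left l x y φ)
    (fun c x φ => Subtype.ext <| funext fun l => P.thetaFun_smul_left l c x φ)
    (fun x φ ψ => Subtype.ext <| funext fun l => P.thetaFun_add l x φ.1 ψ.1)
    (fun c x φ => Subtype.ext <| funext fun l => P.thetaFun_smul l x c φ.1)

theorem theta_nil (x : L) (φ : P.orbitSpace) :
    (P.theta x φ).1 [] = P.der x (φ.1 []) - φ.1 [x] := rfl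

theorem shift_theta (x y : L) (φ : P.orbitSpace) :
    P.shift y (P.theta x φ) = P.theta (P.tr y x) φ + P.theta x (P.shift y φ) := rfl

theorem orbitSpace_ext {φ ψ : P.orbitSpace} (h0 : φ.1 [] = ψ.1 [])
    (h : ∀ y, P.shift y φ = P.shift y ψ) : φ = ψ := by
  ext l
  cases l with
  | nil => exact h0
  | cons y l => exact congrFun (congrArg Subtype.val (h y)) l

theorem theta_lie (x y : L) (φ : P.orbitSpace) :
    P.theta ⁅x, y⁆ φ = P.theta x (P.theta y φ) - P.theta y (P.theta x φ) := by
  ext l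
  induction l generalizing x y φ with
  | nil =>
    change (P.theta ⁅x, y⁆ φ).1 [] =
      (P.theta x (P.theta y φ)).1 [] - (P.theta y (P.theta x φ)).1 []
    have s : ∀ a b : L, (P.theta b φ).1 [a] = (P.shift a (P.theta b φ)).1 [] := fun _ _ => rfl
    have s' : ∀ a b : L, (P.shift a φ).1 [b] = φ.1 [a, b] := fun _ _ => rfl
    have s'' : ∀ a : L, (P.shift a φ).1 [] = φ.1 [a] := fun _ => rfl
    have t : ∀ a b : P.orbitSpace, (a + b).1 [] = a.1 [] + b.1 [] := fun _ _ => rfl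
    simp only [theta_nil, s, shift_theta, t, s', s'', map_sub]
    have h1 := φ.2.2.2 [] [] x y
    simp only [List.nil_append] at h1
    have h2 : φ.1 [P.dbl x y] = φ.1 [P.tr x y] - φ.1 [P.tr y x] + φ.1 [⁅x, y⁆] := by
      have a1 := φ.2.1 [] [] (P.tr x y - P.tr y x) ⁅x, y⁆
      have a2 := φ.2.1 [] [] (P.tr x y - P.tr y x) (P.tr y x)
      simp only [List.nil_append, sub_add_cancel] at a1 a2
      rw [dbl, a1, a2]; abel
    have h3 := P.der_dbl x y (φ.1 [])
    have h4 : φ.1 [x, y] = φ.1 [y, x] - φ.1 [P.dbl x y] := by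
      rw [sub_eq_add_neg, ← h1]; abel
    have h5 : P.der ⁅x, y⁆ (φ.1 []) = P.der x (P.der y (φ.1 [])) - P.der y (P.der x (φ.1 []))
        - (P.der (P.tr x y) (φ.1 []) - P.der (P.tr y x) (φ.1 [])) := by
      rw [← h3, dbl]
      simp only [map_add, map_sub, LinearMap.add_apply, LinearMap.sub_apply]; abel
    rw [h5, h4, h2]; abel
  | cons z l ih =>
    change (P.shift z (P.theta ⁅x, y⁆ φ)).1 l =
      (P.shift z (P.theta x (P.theta y φ))).1 l - (P.shift z (P.theta y (P.theta x φ))).1 l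
    have t : ∀ a b : P.orbitSpace, (a + b).1 l = a.1 l + b.1 l := fun _ _ => rfl
    have t' : ∀ a b : P.orbitSpace, (a - b).1 l = a.1 l - b.1 l := fun _ _ => rfl
    simp only [shift_theta, P.tr_lie, map_add, LinearMap.add_apply, t]
    simp only [ih, t']
    abel

/-- The record of `1 ∈ 𝓤(L)` acting on `v`. -/
def unitOrbit : UniversalEnvelopingAlgebra k L →ₗ[k] P.orbitSpace where
  toFun v := ⟨fun l => match l with
      | [] => v
      | _ :: _ => 0,
    fun l m x y => by cases l <;> simp, fun l m c x => by cases l <;> simp,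
    fun l m x y => by cases l <;> simp⟩
  map_add' v w := Subtype.ext <| funext fun l => by cases l <;> simp
  map_smul' c v := Subtype.ext <| funext fun l => by cases l <;> simp

/-- The action of `𝓤(L)` on the auxiliary space. -/
noncomputable def thetaAlg : UniversalEnvelopingAlgebra k L →ₐ[k] Module.End k P.orbitSpace :=
  UniversalEnvelopingAlgebra.lift k
    { P.theta with
      map_lie' := fun {x y} => LinearMap.ext fun φ => P.theta_lie x y φ }

theorem thetaAlg_ι (x : L) : P.thetaAlg (ι x) = P.theta x := by
  rw [thetaAlg, UniversalEnvelopingAlgebra.lift_ι_apply]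
  rfl

/-- The extension `A ▷ B` of the post-Lie product to the enveloping algebra `𝓤(L)`. It is the
unique bilinear product with the properties `trU_one`, `trU_ι_mul_ι`, `trU_mul`, `trU_ι_ι`
below. -/
noncomputable def trU : UniversalEnvelopingAlgebra k L →ₗ[k]
    UniversalEnvelopingAlgebra k L →ₗ[k] UniversalEnvelopingAlgebra k L :=
  LinearMap.mk₂ k (fun A v => (P.thetaAlg A (P.unitOrbit v)).1 [])
    (fun A B v => by simp) (fun c A v => by simp) (fun A v w => by simp) (fun c A v => by simp)

theorem trU_one (B : UniversalEnvelopingAlgebra k L) : P.trU 1 B = B := by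
  simp [trU, unitOrbit]

theorem shift_thetaAlg (y : L) (A : UniversalEnvelopingAlgebra k L) (φ : P.orbitSpace) :
    P.shift y (P.thetaAlg A φ) = P.thetaAlg (P.der y A) φ + P.thetaAlg A (P.shift y φ) := by
  induction A using env_induction generalizing φ with
  | h1 => simp
  | hmul x A h =>
    simp only [der_mul, der_ι, map_add, map_mul, Module.End.mul_apply, LinearMap.add_apply,
      thetaAlg_ι, shift_theta, h]
    abel
  | hadd A B hA hB => simp only [map_add, LinearMap.add_apply, hA, hB]; abel
  | hsmul c A hA => simp only [map_smul, LinearMap.smul_apply, hA, smul_add]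

theorem trU_ι_mul (x : L) (A B : UniversalEnvelopingAlgebra k L) :
    P.trU (ι x * A) B = P.der x (P.trU A B) - P.trU (P.der x A) B := by
  have h : P.shift x (P.unitOrbit B) = 0 := rfl
  have h2 := P.shift_thetaAlg x A (P.unitOrbit B)
  rw [h, map_zero, add_zero] at h2
  simp only [trU, LinearMap.mk₂_apply, map_mul, Module.End.mul_apply, thetaAlg_ι, theta_nil, ← h2]
  rfl

theorem trU_ι (x : L) (B : UniversalEnvelopingAlgebra k L) : P.trU (ι x) B = P.der x B := by
  simpa [trU_one] using P.trU_ι_mul x 1 B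

theorem trU_ι_ι (x y : L) : P.trU (ι x) (ι y) = ι (P.tr x y) := by
  rw [trU_ι, der_ι]

theorem trU_ι_mul_ι (x : L) (A : UniversalEnvelopingAlgebra k L) (y : L) :
    P.trU (ι x * A) (ι y) = P.trU (ι x) (P.trU A (ι y)) - P.trU (P.trU (ι x) A) (ι y) := by
  rw [trU_ι_mul, trU_ι, trU_ι]

variable (k L) in
/-- The coshuffle coproduct of `𝓤(L)`: the algebra map with `Δ x = x ⊗ 1 + 1 ⊗ x` on `L`. -/
noncomputable def coproduct : UniversalEnvelopingAlgebra k L →ₐ[k]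
    UniversalEnvelopingAlgebra k L ⊗[k] UniversalEnvelopingAlgebra k L :=
  UniversalEnvelopingAlgebra.lift k
    { toFun := fun x => ι x ⊗ₜ[k] 1 + 1 ⊗ₜ[k] ι x
      map_add' := fun x y => by
        simp only [map_add, TensorProduct.add_tmul, TensorProduct.tmul_add]; abel
      map_smul' := fun c x => by
        simp only [map_smul, RingHom.id_apply, smul_add, TensorProduct.smul_tmul',
          TensorProduct.tmul_smul]
      map_lie' := fun {x y} => by
        simp only [LieHom.map_lie, LieRing.of_associative_ring_bracket, mul_add, add_mul,
          Algebra.TensorProduct.tmul_mul_tmul, mul_one, one_mul, TensorProduct.sub_tmul,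
          TensorProduct.tmul_sub]
        abel }

theorem coproduct_ι (x : L) : coproduct k L (ι x) = ι x ⊗ₜ[k] 1 + 1 ⊗ₜ[k] ι x := by
  rw [coproduct, UniversalEnvelopingAlgebra.lift_ι_apply]
  rfl

theorem coproduct_der (x : L) (A : UniversalEnvelopingAlgebra k L) :
    coproduct k L (P.der x A) =
      TensorProduct.map (P.der x) LinearMap.id (coproduct k L A) +
        TensorProduct.map LinearMap.id (P.der x) (coproduct k L A) := by
  induction A using env_induction with
  | h1 => simp [Algebra.TensorProduct.one_def]
  | hmul y A h =>
    simp only [der_mul, der_ι, map_add, map_mul, h, coproduct_ι]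
    induction coproduct k L A using TensorProduct.induction_on with
    | zero => simp
    | tmul a b =>
      simp only [add_mul, mul_add, Algebra.TensorProduct.tmul_mul_tmul, TensorProduct.map_tmul,
        LinearMap.id_apply, one_mul, map_add, der_mul, der_ι, TensorProduct.add_tmul,
        TensorProduct.tmul_add]
      abel
    | add a b ha hb =>
      simp only [mul_add, map_add] at ha hb ⊢
      have h := congrArg₂ (· + ·) ha hb
      convert h using 1 <;> abel
  | hadd A B hA hB => simp only [map_add, hA, hB]; abel
  | hsmul c A hA => simp only [map_smul, hA, smul_add]

/-- The map `T₁ ⊗ T₂ ↦ (T₁ ▷ B) (T₂ ▷ C)`. -/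
noncomputable def trPair (B C : UniversalEnvelopingAlgebra k L) :
    UniversalEnvelopingAlgebra k L ⊗[k] UniversalEnvelopingAlgebra k L →ₗ[k]
      UniversalEnvelopingAlgebra k L :=
  LinearMap.mul' k _ ∘ₗ TensorProduct.map (P.trU.flip B) (P.trU.flip C)

theorem trPair_ι_mul (x : L) (B C : UniversalEnvelopingAlgebra k L)
    (T : UniversalEnvelopingAlgebra k L ⊗[k] UniversalEnvelopingAlgebra k L) :
    P.trPair B C ((ι x ⊗ₜ[k] 1 + 1 ⊗ₜ[k] ι x) * T) = P.der x (P.trPair B C T) -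
      P.trPair B C (TensorProduct.map (P.der x) LinearMap.id T +
        TensorProduct.map LinearMap.id (P.der x) T) := by
  induction T using TensorProduct.induction_on with
  | zero => simp
  | tmul a c =>
    simp only [trPair, add_mul, Algebra.TensorProduct.tmul_mul_tmul, TensorProduct.map_tmul,
      LinearMap.id_apply, one_mul, map_add, LinearMap.comp_apply, LinearMap.mul'_apply,
      LinearMap.flip_apply, trU_ι_mul, der_mul]
    noncomm_ring
  | add S T hS hT =>
    rw [mul_add, map_add, hS, hT]
    simp only [map_add]
    abel

/-- `A ▷ (B C) = (A₍₁₎ ▷ B) (A₍₂₎ ▷ C)`. -/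
theorem trU_mul (A B C : UniversalEnvelopingAlgebra k L) :
    P.trU A (B * C) = P.trPair B C (coproduct k L A) := by
  suffices h : ∀ l : List L, P.trU (l.foldl (fun D y => P.der y D) A) (B * C) =
      P.trPair B C (coproduct k L (l.foldl (fun D y => P.der y D) A)) from h []
  have fadd : ∀ (l : List L) (D E : 𝓤), l.foldl (fun D y => P.der y D) (D + E) =
      l.foldl (fun D y => P.der y D) D + l.foldl (fun D y => P.der y D) E := by
    intro l
    induction l with
    | nil => simp
    | cons y l ih => intro D E; simp only [List.foldl_cons, map_add, ih]
  have fsmul : ∀ (l : List L) (c : k) (D : 𝓤), l.foldl (fun D y => P.der y D) (c • D) =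
      c • l.foldl (fun D y => P.der y D) D := by
    intro l
    induction l with
    | nil => simp
    | cons y l ih => intro c D; simp only [List.foldl_cons, map_smul, ih]
  induction A using env_induction with
  | h1 =>
    intro l
    cases l with
    | nil => simp [trU_one, trPair, Algebra.TensorProduct.one_def]
    | cons y l =>
      have h0 : l.foldl (fun D y => P.der y D) (0 : 𝓤) = 0 := by simpa using fsmul l 0 0
      simp [h0]
  | hmul x A h =>
    intro l
    induction l generalizing x A with
    | nil =>
      have h0 := h []
      have h1 := h [x]
      simp only [List.foldl_nil, List.foldl_cons] at h0 h1 ⊢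
      rw [trU_ι_mul, h0, h1, map_mul, coproduct_ι, trPair_ι_mul, coproduct_der]
    | cons y l ih =>
      simp only [List.foldl_cons, der_mul, der_ι, fadd, map_add, LinearMap.add_apply]
      rw [ih (P.tr y x) A h, ih x (P.der y A) fun m => h (y :: m)]
  | hadd A D hA hD =>
    intro l
    simp only [fadd, map_add, LinearMap.add_apply, hA l, hD l]
  | hsmul c A hA =>
    intro l
    simp only [fsmul, map_smul, LinearMap.smul_apply, hA l]

/-- The product `A * B = A₍₁₎ (A₍₂₎ ▷ B)` on `𝓤(L)`. -/
noncomputable def star : UniversalEnvelopingAlgebra k L →ₗ[k]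
    UniversalEnvelopingAlgebra k L →ₗ[k] UniversalEnvelopingAlgebra k L :=
  LinearMap.mk₂ k
    (fun A B => LinearMap.mul' k _
      (TensorProduct.map LinearMap.id (P.trU.flip B) (coproduct k L A)))
    (fun A B C => by simp) (fun c A B => by simp)
    (fun A B C => by simp [TensorProduct.map_add_right])
    (fun c A B => by simp [TensorProduct.map_smul_right])

/-! ### Formal series in the step size

The formal variable `h` is `PowerSeries.X`. Elements of the completion are power series in `h`
with coefficients in `𝓤(L)`, and all operations are extended `h`-linearly. -/

/-- The `h`-bilinear extension of a bilinear operation of `𝓤(L)` to `𝓤(L)⟦h⟧`. -/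
noncomputable def extendSeries
    (m : UniversalEnvelopingAlgebra k L →ₗ[k]
      UniversalEnvelopingAlgebra k L →ₗ[k] UniversalEnvelopingAlgebra k L)
    (α β : (UniversalEnvelopingAlgebra k L)⟦X⟧) : (UniversalEnvelopingAlgebra k L)⟦X⟧ :=
  PowerSeries.mk fun n =>
    ∑ ij ∈ Finset.HasAntidiagonal.antidiagonal n, m (PowerSeries.coeff ij.1 α) (PowerSeries.coeff ij.2 β)

variable (k) in
/-- The series `h f`. -/
noncomputable def stepSeries (f : L) : (UniversalEnvelopingAlgebra k L)⟦X⟧ :=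
  PowerSeries.monomial 1 (ι f)

/-- Infinitesimal characters: `Δ α = α ⊗ 1 + 1 ⊗ α`, coefficient by coefficient, with no term of
order `h ^ 0`. -/
def IsInfinitesimalCharacter (α : (UniversalEnvelopingAlgebra k L)⟦X⟧) : Prop :=
  PowerSeries.coeff 0 α = 0 ∧
    ∀ n, coproduct k L (PowerSeries.coeff n α) =
      PowerSeries.coeff n α ⊗ₜ[k] 1 + 1 ⊗ₜ[k] PowerSeries.coeff n α

/-- `exp α = ∑ αʲ / j!` for the concatenation product. For `α` without constant term only
`j ≤ n` contribute to the coefficient of `h ^ n`. -/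
noncomputable def expSeries (α : (UniversalEnvelopingAlgebra k L)⟦X⟧) :
    (UniversalEnvelopingAlgebra k L)⟦X⟧ :=
  PowerSeries.mk fun n =>
    ∑ j ∈ Finset.range (n + 1), (j.factorial : k)⁻¹ • PowerSeries.coeff n (α ^ j)

/-- The `j`-th power of `α` for the product `*`. -/
noncomputable def starPow (α : (UniversalEnvelopingAlgebra k L)⟦X⟧) :
    ℕ → (UniversalEnvelopingAlgebra k L)⟦X⟧
  | 0 => 1
  | j + 1 => extendSeries P.star α (starPow α j)

/-- `exp* α = ∑ α^{*j} / j!`, for `α` without constant term. -/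
noncomputable def expStarSeries (α : (UniversalEnvelopingAlgebra k L)⟦X⟧) :
    (UniversalEnvelopingAlgebra k L)⟦X⟧ :=
  PowerSeries.mk fun n =>
    ∑ j ∈ Finset.range (n + 1), (j.factorial : k)⁻¹ • PowerSeries.coeff n (P.starPow α j)

/-- `dexp⁻¹_U(V) = ∑_{j ≤ N} (B_j / j!) ad_U^j(V) = V + [U, V] / 2 + [U, [U, V]] / 12 + ⋯`, for `U`
without constant term; the Bernoulli numbers are those with `B₁ = 1/2`. The full series is
`N = ⊤`, a natural number `N` gives its truncation. -/
noncomputable def dexpInv (N : ℕ∞) (U V : (UniversalEnvelopingAlgebra k L)⟦X⟧) :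
    (UniversalEnvelopingAlgebra k L)⟦X⟧ :=
  PowerSeries.mk fun n =>
    ∑ j ∈ (Finset.range (n + 1)).filter (fun j : ℕ => (j : ℕ∞) ≤ N),
      ((bernoulli' j : k) / (j.factorial : k)) •
        PowerSeries.coeff n ((fun W => U * W - W * U)^[j] V)

/-- The stage equations `Uᵢ = ∑ⱼ aᵢⱼ Kⱼ`, `Kᵢ = dexp⁻¹_{Uᵢ}(exp(Uᵢ) ▷ F)` of the RKMK method
applied to `F`, for infinitesimal characters `Kᵢ`. -/
def IsRKMKStages (N : ℕ∞) {s : ℕ} (a : Matrix (Fin s) (Fin s) k)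
    (F : (UniversalEnvelopingAlgebra k L)⟦X⟧)
    (K : Fin s → (UniversalEnvelopingAlgebra k L)⟦X⟧) : Prop :=
  ∀ i, IsInfinitesimalCharacter (K i) ∧
    K i = dexpInv N (∑ j, a i j • K j)
      (extendSeries P.trU (expSeries (∑ j, a i j • K j)) F)

/-- The output `exp(∑ᵢ bᵢ Kᵢ)` of the RKMK method with stages `K`. -/
noncomputable def rkmkOutput {s : ℕ} (b : Fin s → k)
    (K : Fin s → (UniversalEnvelopingAlgebra k L)⟦X⟧) : (UniversalEnvelopingAlgebra k L)⟦X⟧ :=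
  expSeries (∑ i, b i • K i)

end Extension

end PostLieAlgebra

/-- Rooted trees; `node [τ₁, …, τₙ]` is `B⁺(τ₁ ⋯ τₙ)`. The functions below do not depend on the
order of the branches, so every non-planar rooted tree may be represented by any of its planar
forms. -/
inductive ButcherTree : Type
  | node : List ButcherTree → ButcherTree

namespace ButcherTree

/-- The number of vertices `|τ|`. -/
def order : ButcherTree → ℕ
  | node ts => 1 + (ts.map fun t => order t).sum

/-- The tree factorial `τ! = |τ| τ₁! ⋯ τₙ!`. -/
def factorial : ButcherTree → ℕ
  | node ts => order (node ts) * (ts.map fun t => factorial t).prod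

/-- The stage weights: the vector `Φ(τ)` with `Φ(•) = (1, …, 1)` and
`Φ(B⁺(τ₁ ⋯ τₙ)) = AΦ(τ₁) ⋯ AΦ(τₙ)` (componentwise product). -/
def stageWeight {k : Type*} [Field k] {s : ℕ} (a : Matrix (Fin s) (Fin s) k) :
    ButcherTree → Fin s → k
  | node ts, i => (ts.map fun t => ∑ j, a i j * stageWeight a t j).prod

end ButcherTree

/-- The classical Runge-Kutta order conditions up to order `p`: `∑ᵢ bᵢ Φᵢ(τ) = 1 / τ!` for all
rooted trees `τ` with `|τ| ≤ p`. -/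
def ButcherOrderConditions {k : Type*} [Field k] {s : ℕ} (a : Matrix (Fin s) (Fin s) k)
    (b : Fin s → k) (p : ℕ) : Prop :=
  ∀ τ : ButcherTree, τ.order ≤ p →
    ∑ i, b i * ButcherTree.stageWeight a τ i = 1 / (τ.factorial : k)

/-!
The RKMK method is the underlying Runge-Kutta method applied to the formal differential equation
`h u' = dexp⁻¹_u (exp(u) ▷ h f)`, `u(0) = 0`, on the Lie algebra, whose solution is the logarithm of
`exp*(h f)`.

*Stages.* The coefficient of `hⁿ` in `dexp⁻¹_U (exp(U) ▷ h f)` depends on the coefficients of `U`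
below degree `n` only, so the stage equations are a fixed point problem for an `h`-adic contraction
(`IsContraction.existsUnique_fixedPoint`). The extended product sends `𝓤(L) ⊗ L` to `L`
(`trU_ι_mem_range`), and primitive elements are closed under commutators, so the fixed point
consists of infinitesimal characters.

*Exact solution.* The derivative of the exponential is
`(exp u)' = exp(u) ((1 - e^{-ad_u}) / ad_u) u'` (`euler_sumSeries_exp`), and the Bernoulli series
inverts the operator on the right (`dexp_dexpInv`). Hence `Y = exp(u)` satisfies
`h Y' = Y (Y ▷ h f)`. Since `Y ▷ h f` is primitive, `Δ Y` and `Y ⊗ Y` solve the same linear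
equation, so `Y` is grouplike and `Y (Y ▷ h f) = Y * h f`. Associativity of `*` for a first factor
in `L` then gives `Y = exp*(h f)` (`eq_expStarSeries_of_euler_eq`).

*Order.* It remains to compare `∑ᵢ bᵢ Kᵢ` with `u`, which is the classical order theory of
Runge-Kutta methods for the differential equation on the Lie algebra. The right-hand side is a
sum of (not symmetrised) multilinear maps of its argument, so planar trees without symmetry factors
suffice. No elementary differentials are computed: the internal stages `Uᵢ` and `u` form one tuple
`x`, indexed by `Option (Fin s)`, and by induction the coefficient of `hⁿ` of `x` lies in the span
of the tuples `i ↦ (∏_{τ ∈ ts} weight τ i) • A` over forests `ts` with `n` vertices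
(`ButcherTree.forestSpan`). Products of series concatenate forests (`bilin_mem_forestSpan`); the
passage from the derivatives back to the stages and to `u` grafts a forest onto a new root
(`graft_mem_forestSpan`), because `stageWeight` and `1 / τ!` obey the corresponding recursions.
The order conditions make the linear functional `∑ᵢ bᵢ Kᵢ - u` vanish on these spans up to degree
`p`. Dropping the terms `ad_U^j` with `j > N ≥ p - 1` changes nothing up to degree `p`, as `U` and
`exp(U) ▷ h f` have no constant term (`coeff_dexpInv_of_le`).
-/

section

open PowerSeries Finset

/-! ### Fixed points of contractions on tuples of formal series -/

section FixedPoint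

variable {ι R : Type*} [Ring R]

/-- Two tuples of formal series agree below degree `n`. -/
def AgreeBelow (n : ℕ) (x y : ι → R⟦X⟧) : Prop := ∀ i, ∀ m < n, coeff m (x i) = coeff m (y i)

/-- A contraction for the `h`-adic metric: one more coefficient of the output is determined
than is known of the input. -/
def IsContraction (Ψ : (ι → R⟦X⟧) → (ι → R⟦X⟧)) : Prop :=
  ∀ n x y, AgreeBelow n x y → AgreeBelow (n + 1) (Ψ x) (Ψ y)

theorem IsContraction.agreeBelow_iterate {Ψ : (ι → R⟦X⟧) → (ι → R⟦X⟧)} (hΨ : IsContraction Ψ)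
    (n : ℕ) (x y : ι → R⟦X⟧) : AgreeBelow n (Ψ^[n] x) (Ψ^[n] y) := by
  induction n with
  | zero => intro i m hm; omega
  | succ n ih => simp only [Function.iterate_succ_apply']; exact hΨ _ _ _ ih

theorem IsContraction.existsUnique_fixedPoint {Ψ : (ι → R⟦X⟧) → (ι → R⟦X⟧)}
    (hΨ : IsContraction Ψ) : ∃! x, Ψ x = x := by
  have hstep : ∀ m, AgreeBelow m (Ψ^[m + 1] 0) (Ψ^[m] 0) := fun m => by
    rw [Function.iterate_succ_apply]; exact hΨ.agreeBelow_iterate m _ _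
  have hle : ∀ n d, AgreeBelow n (Ψ^[n + d] 0) (Ψ^[n] 0) := by
    intro n d
    induction d with
    | zero => intro i m _; rfl
    | succ d ih => intro i m hm; exact (hstep (n + d) i m (by omega)).trans (ih i m hm)
  let x : ι → R⟦X⟧ := fun i => mk fun n => coeff n (Ψ^[n + 1] 0 i)
  have hx : ∀ n, AgreeBelow n x (Ψ^[n] 0) := by
    intro n i m hm
    obtain ⟨d, rfl⟩ := Nat.exists_eq_add_of_le (Nat.succ_le_of_lt hm)
    simp only [x, coeff_mk]
    exact (hle (m + 1) d i m (by omega)).symm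
  refine ⟨x, ?_, ?_⟩
  · funext i
    ext n
    have h1 := hΨ n _ _ (hx n) i n (by omega)
    rw [h1, ← Function.iterate_succ_apply' Ψ]
    exact (hx (n + 1) i n (by omega)).symm
  · intro y hy
    funext i
    ext n
    have h1 := hΨ.agreeBelow_iterate (n + 1) y 0 i n (by omega)
    rw [Function.iterate_fixed hy] at h1
    rw [h1]; exact (hx (n + 1) i n (by omega)).symm

/-- A graded condition on the coefficients that holds for `0` and is preserved by a contraction
holds for its fixed point. -/
theorem IsContraction.fixedPoint_induction {Ψ : (ι → R⟦X⟧) → (ι → R⟦X⟧)}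
    (hΨ : IsContraction Ψ) (Q : ℕ → (ι → R) → Prop) (h0 : ∀ n, Q n 0)
    (hQ : ∀ x : ι → R⟦X⟧, (∀ n, Q n fun i => coeff n (x i)) → ∀ n, Q n fun i => coeff n (Ψ x i))
    {x : ι → R⟦X⟧} (hx : Ψ x = x) (n : ℕ) : Q n fun i => coeff n (x i) := by
  have hit : ∀ m n, Q n fun i => coeff n (Ψ^[m] 0 i) := by
    intro m
    induction m with
    | zero => exact h0
    | succ m ih => simp only [Function.iterate_succ_apply']; exact hQ _ ih
  have h : (fun i => coeff n (x i)) = fun i => coeff n (Ψ^[n + 1] 0 i) := by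
    funext i
    have h1 := hΨ.agreeBelow_iterate (n + 1) x 0 i n (by omega)
    rwa [Function.iterate_fixed hx] at h1
  rw [h]
  exact hit (n + 1) n

end FixedPoint

/-! ### Locally finite sums, the Euler operator and the exponential -/

section Series

variable {k R : Type*} [Field k] [Ring R] [Algebra k R]

theorem coeff_mul_eq_zero {α β : R⟦X⟧} {i j n : ℕ} (hα : ∀ m < i, coeff m α = 0)
    (hβ : ∀ m < j, coeff m β = 0) (hn : n < i + j) : coeff n (α * β) = 0 := by
  rw [coeff_mul]
  refine sum_eq_zero fun p hp => ?_
  rw [HasAntidiagonal.mem_antidiagonal] at hp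
  rcases lt_or_ge p.1 i with h | h
  · rw [hα _ h, zero_mul]
  · rw [hβ _ (by omega), mul_zero]

variable (R) in
/-- The map `ad_U : W ↦ U W - W U`. -/
noncomputable def adL (U : R) : R →ₗ[ℤ] R := LinearMap.mulLeft ℤ U - LinearMap.mulRight ℤ U

theorem coeff_pow_eq_zero {U : R⟦X⟧} (hU : coeff 0 U = 0) {n j : ℕ} (hn : n < j) :
    coeff n (U ^ j) = 0 := by
  induction j generalizing n with
  | zero => omega
  | succ j ih =>
    rw [pow_succ]
    exact coeff_mul_eq_zero (i := j) (j := 1) (fun m hm => ih hm)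
      (fun m hm => by obtain rfl : m = 0 := by omega
                      exact hU) (by omega)

/-- `ad_U^j V` as it occurs in `dexp⁻¹`. -/
def adIter (U : R) (j : ℕ) (V : R) : R := (fun W => U * W - W * U)^[j] V

theorem adIter_zero (U V : R) : adIter U 0 V = V := rfl

theorem adIter_succ (U : R) (j : ℕ) (V : R) :
    adIter U (j + 1) V = U * adIter U j V - adIter U j V * U := by
  simp only [adIter, Function.iterate_succ_apply']

theorem adIter_add (U : R) (i j : ℕ) (V : R) :
    adIter U (i + j) V = adIter U i (adIter U j V) := by
  simp only [adIter, Function.iterate_add_apply]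

/-- `ad_U^j V` has order at least `j + c` if `V` has order at least `c`. -/
theorem coeff_adIter_eq_zero {U V : R⟦X⟧} (hU : coeff 0 U = 0) {c : ℕ}
    (hV : ∀ m < c, coeff m V = 0) {n j : ℕ} (hn : n < j + c) : coeff n (adIter U j V) = 0 := by
  have hU' : ∀ m < 1, coeff m U = 0 := fun m hm => by
    obtain rfl : m = 0 := by omega
    exact hU
  induction j generalizing n with
  | zero => exact hV n (by omega)
  | succ j ih =>
    rw [adIter_succ, map_sub,
      coeff_mul_eq_zero (i := 1) (j := j + c) hU' (fun m hm => ih hm) (by omega),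
      coeff_mul_eq_zero (i := j + c) (j := 1) (fun m hm => ih hm) hU' (by omega), sub_zero]

/-- The locally finite sum `∑ⱼ aⱼ` of series `aⱼ` of order at least `j`. -/
noncomputable def sumSeries (a : ℕ → R⟦X⟧) : R⟦X⟧ :=
  PowerSeries.mk fun n => ∑ j ∈ range (n + 1), coeff n (a j)

theorem coeff_sumSeries {a : ℕ → R⟦X⟧} (ha : ∀ j, ∀ n < j, coeff n (a j) = 0) {n M : ℕ}
    (hM : n < M) : coeff n (sumSeries a) = ∑ j ∈ range M, coeff n (a j) := by
  rw [sumSeries, coeff_mk]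
  refine sum_subset (fun j hj => by simp at hj ⊢; omega) fun j _ hj => ?_
  exact ha j n (by simp at hj; omega)

theorem sum_range_sum_range_eq {M' : Type*} [AddCommMonoid M'] (M : ℕ) (g : ℕ → ℕ → M')
    (hg : ∀ i j, M ≤ i + j → g i j = 0) :
    ∑ i ∈ range M, ∑ j ∈ range M, g i j =
      ∑ m ∈ range M, ∑ p ∈ antidiagonal m, g p.1 p.2 := by
  rw [← sum_product', sum_sigma']
  symm
  refine sum_of_injOn (fun q => q.2) ?_ ?_ ?_ ?_
  · rintro ⟨m, p⟩ h ⟨m', p'⟩ h' e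
    simp only [coe_sigma, Set.mem_sigma_iff, mem_coe, HasAntidiagonal.mem_antidiagonal] at h h'
    simp only at e
    subst e
    obtain rfl : m = m' := by omega
    rfl
  · rintro ⟨m, p⟩ h
    simp only [coe_sigma, Set.mem_sigma_iff, mem_coe, HasAntidiagonal.mem_antidiagonal,
      mem_range] at h
    simp only [coe_product, Set.mem_prod, mem_coe, mem_range]
    omega
  · rintro ⟨i, j⟩ _ h
    refine hg i j ?_
    by_contra hlt
    refine h ⟨⟨i + j, (i, j)⟩, ?_, rfl⟩
    simp only [coe_sigma, Set.mem_sigma_iff, mem_coe, HasAntidiagonal.mem_antidiagonal, mem_range,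
      and_true]
    omega
  · intros; rfl

theorem sumSeries_mul {a b : ℕ → R⟦X⟧} (ha : ∀ j, ∀ n < j, coeff n (a j) = 0)
    (hb : ∀ j, ∀ n < j, coeff n (b j) = 0) :
    sumSeries a * sumSeries b =
      sumSeries fun m => ∑ p ∈ antidiagonal m, a p.1 * b p.2 := by
  ext n
  have hab : ∀ i j, n + 1 ≤ i + j → coeff n (a i * b j) = 0 := fun i j h =>
    coeff_mul_eq_zero (ha i) (hb j) (by omega)
  have key : coeff n (sumSeries a * sumSeries b) =
      coeff n ((∑ i ∈ range (n + 1), a i) * ∑ j ∈ range (n + 1), b j) := by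
    rw [coeff_mul, coeff_mul]
    refine sum_congr rfl fun p hp => ?_
    rw [HasAntidiagonal.mem_antidiagonal] at hp
    rw [coeff_sumSeries ha (M := n + 1) (by omega), coeff_sumSeries hb (M := n + 1) (by omega),
      map_sum, map_sum]
  rw [key, sum_mul_sum, sumSeries, coeff_mk]
  simp only [map_sum]
  exact sum_range_sum_range_eq (n + 1) (fun i j => coeff n (a i * b j)) hab

theorem mul_sumSeries (U : R⟦X⟧) {a : ℕ → R⟦X⟧} (ha : ∀ j, ∀ n < j, coeff n (a j) = 0) :
    U * sumSeries a = sumSeries fun j => U * a j := by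
  ext n
  rw [sumSeries.eq_def (fun j => U * a j), coeff_mk, ← map_sum, ← mul_sum, coeff_mul, coeff_mul]
  refine sum_congr rfl fun p hp => ?_
  rw [HasAntidiagonal.mem_antidiagonal] at hp
  rw [coeff_sumSeries ha (M := n + 1) (by omega), map_sum]

theorem sumSeries_mul_right (U : R⟦X⟧) {a : ℕ → R⟦X⟧} (ha : ∀ j, ∀ n < j, coeff n (a j) = 0) :
    sumSeries a * U = sumSeries fun j => a j * U := by
  ext n
  rw [sumSeries.eq_def (fun j => a j * U), coeff_mk, ← map_sum, ← sum_mul, coeff_mul, coeff_mul]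
  refine sum_congr rfl fun p hp => ?_
  rw [HasAntidiagonal.mem_antidiagonal] at hp
  rw [coeff_sumSeries ha (M := n + 1) (by omega), map_sum]

theorem sumSeries_sub (a b : ℕ → R⟦X⟧) :
    sumSeries a - sumSeries b = sumSeries fun j => a j - b j := by
  ext n
  simp [sumSeries, sum_sub_distrib]

theorem adIter_sumSeries {U : R⟦X⟧} (hU : coeff 0 U = 0) {a : ℕ → R⟦X⟧}
    (ha : ∀ j, ∀ n < j, coeff n (a j) = 0) (r : ℕ) :
    adIter U r (sumSeries a) = sumSeries fun j => adIter U r (a j) := by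
  induction r with
  | zero => rfl
  | succ r ih =>
    have h : ∀ j, ∀ n < j, coeff n (adIter U r (a j)) = 0 := fun j n hn =>
      coeff_adIter_eq_zero hU (ha j) (by omega)
    rw [adIter_succ, ih, mul_sumSeries U h, sumSeries_mul_right U h, sumSeries_sub]
    simp only [adIter_succ]

theorem adIter_smul (U V : R) (c : k) (r : ℕ) : adIter U r (c • V) = c • adIter U r V := by
  induction r with
  | zero => rfl
  | succ r ih => rw [adIter_succ, adIter_succ, ih, mul_smul_comm, smul_mul_assoc, smul_sub]

theorem coeff_smul_algebra (c : k) (α : R⟦X⟧) (n : ℕ) : coeff n (c • α) = c • coeff n α := rfl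

/-- The Euler operator `h d/dh`. -/
noncomputable def euler (α : R⟦X⟧) : R⟦X⟧ := PowerSeries.mk fun n => n • coeff n α

@[simp] theorem coeff_euler (n : ℕ) (α : R⟦X⟧) : coeff n (euler α) = n • coeff n α := coeff_mk _ _

theorem euler_one : euler (1 : R⟦X⟧) = 0 := by
  ext n
  rw [coeff_euler, coeff_one]
  by_cases h : n = 0 <;> simp [h]

theorem euler_mul (α β : R⟦X⟧) : euler (α * β) = euler α * β + α * euler β := by
  ext n
  simp only [coeff_euler, map_add, coeff_mul, smul_sum, ← sum_add_distrib]
  refine sum_congr rfl fun p hp => ?_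
  rw [HasAntidiagonal.mem_antidiagonal] at hp
  rw [smul_mul_assoc, mul_smul_comm, ← add_smul, hp]

/-- `V Uᵐ = ∑ᵣ (m choose r) Uᵐ⁻ʳ (-ad_U)ʳ V`. -/
theorem mul_pow_eq_sum_adIter (U V : R) (m : ℕ) :
    V * U ^ m = ∑ r ∈ range (m + 1),
      ((m.choose r : ℤ) * (-1) ^ r) • (U ^ (m - r) * adIter U r V) := by
  have hc : Commute (-adL R U) (LinearMap.mulLeft ℤ U) := by
    refine Commute.neg_left ?_
    exact Commute.sub_left rfl (LinearMap.commute_mulLeft_right U U).symm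
  have h := hc.add_pow m
  have e : -adL R U + LinearMap.mulLeft ℤ U = LinearMap.mulRight ℤ U := by simp [adL]
  have hit : ∀ r W, ((adL R U) ^ r) W = adIter U r W := by
    intro r W
    rw [Module.End.pow_apply]
    rfl
  rw [e] at h
  have h2 := congrArg (fun T : R →ₗ[ℤ] R => T V) h
  simp only [LinearMap.pow_mulRight, LinearMap.mulRight_apply, LinearMap.sum_apply] at h2
  rw [h2]
  refine sum_congr rfl fun r _ => ?_
  rw [((hc.pow_pow r (m - r)).eq), neg_pow, LinearMap.pow_mulLeft]
  have : ((m.choose r : ℕ) : Module.End ℤ R) = (m.choose r : ℤ) • (1 : Module.End ℤ R) := by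
    simp
  rw [this]
  have h1 : ((-1 : Module.End ℤ R)) ^ r = ((-1 : ℤ) ^ r) • (1 : Module.End ℤ R) := by
    rcases Nat.even_or_odd r with h | h <;> simp [h.neg_one_pow]
  rw [h1]
  simp only [mul_smul_comm, smul_mul_assoc, mul_one, one_mul, LinearMap.smul_apply,
    Module.End.mul_apply, LinearMap.mulLeft_apply, hit, smul_smul]

/-- `D(Uᵐ) = ∑ᵣ (m choose r+1) Uᵐ⁻¹⁻ʳ (-ad_U)ʳ (D U)` for the derivation `D = h d/dh`. -/
theorem euler_pow (U : R⟦X⟧) (m : ℕ) :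
    euler (U ^ m) = ∑ r ∈ range m,
      ((m.choose (r + 1) : ℤ) * (-1) ^ r) • (U ^ (m - 1 - r) * adIter U r (euler U)) := by
  induction m with
  | zero => simp [euler_one]
  | succ m ih =>
    rw [pow_succ', euler_mul, mul_pow_eq_sum_adIter, ih, mul_sum, sum_range_succ, sum_range_succ
      (n := m), add_right_comm, ← sum_add_distrib]
    congr 1
    · refine sum_congr rfl fun r hr => ?_
      rw [mem_range] at hr
      rw [mul_smul_comm, ← mul_assoc, ← pow_succ', Nat.choose_succ_succ,
        show m - 1 - r + 1 = m - r by omega, show m + 1 - 1 - r = m - r by omega, ← add_smul]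
      push_cast
      rw [add_mul, add_comm]
    · simp

end Series

section Exponential

variable {k R : Type*} [Field k] [Ring R] [Algebra k R]

/-- The Bernoulli series `t / (1 - e⁻ᵗ)` is inverse to `(1 - e⁻ᵗ) / t`. -/
theorem sum_antidiagonal_bernoulli' [CharZero k] (m : ℕ) :
    ∑ p ∈ antidiagonal m, ((-1) ^ p.1 / ((p.1 + 1).factorial : k)) *
      ((bernoulli' p.2 : k) / (p.2.factorial : k)) = if m = 0 then 1 else 0 := by
  set Φ : ℚ⟦X⟧ := PowerSeries.mk fun r => (-1) ^ r / ((r + 1).factorial : ℚ) with hΦ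
  have h1 : X * Φ = 1 - evalNegHom (exp ℚ) := by
    ext n
    cases n with
    | zero =>
      rw [coeff_zero_X_mul, map_sub, coeff_one, evalNegHom, coeff_rescale, coeff_exp]
      simp
    | succ n =>
      rw [coeff_succ_X_mul, hΦ, coeff_mk, map_sub, coeff_one, evalNegHom, coeff_rescale, coeff_exp]
      simp [pow_succ]
      ring
  have h2 : X * (Φ * bernoulli'PowerSeries ℚ) = X * 1 := by
    have h := congrArg (· * evalNegHom (exp ℚ)) (bernoulli'PowerSeries_mul_exp_sub_one ℚ)
    simp only [mul_assoc, sub_mul, exp_mul_exp_neg_eq_one, one_mul] at h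
    rw [← mul_assoc, h1, mul_comm, h]
  have h3 : Φ * bernoulli'PowerSeries ℚ = 1 := mul_left_cancel₀ X_ne_zero h2
  have h4 := congrArg (fun α => ((coeff m α : ℚ) : k)) h3
  simp only [coeff_mul, hΦ, coeff_mk, bernoulli'PowerSeries, coeff_one] at h4
  push_cast at h4
  simpa [apply_ite (Rat.cast : ℚ → k)] using h4

variable (k) in
theorem coeff_exp_term_eq_zero {U : R⟦X⟧} (hU : coeff 0 U = 0) (j : ℕ) :
    ∀ n < j, coeff n ((j.factorial : k)⁻¹ • U ^ j) = 0 := fun n hn => by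
  rw [coeff_smul_algebra, coeff_pow_eq_zero hU hn, smul_zero]

theorem coeff_smul_adIter_eq_zero {U : R⟦X⟧} (hU : coeff 0 U = 0) (V : R⟦X⟧) (c : ℕ → k) (j : ℕ) :
    ∀ n < j, coeff n (c j • adIter U j V) = 0 := fun n hn => by
  rw [coeff_smul_algebra, coeff_adIter_eq_zero hU (c := 0) (by simp) (by omega), smul_zero]

theorem euler_pow_div_factorial [CharZero k] (U : R⟦X⟧) (m : ℕ) :
    ((m + 1).factorial : k)⁻¹ • euler (U ^ (m + 1)) = ∑ p ∈ antidiagonal m,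
      ((p.1.factorial : k)⁻¹ • U ^ p.1) *
        (((-1) ^ p.2 / ((p.2 + 1).factorial : k)) • adIter U p.2 (euler U)) := by
  rw [euler_pow, smul_sum, ← Nat.sum_antidiagonal_swap]
  rw [Nat.sum_antidiagonal_eq_sum_range_succ_mk]
  refine sum_congr rfl fun r hr => ?_
  rw [mem_range] at hr
  simp only [Prod.swap]
  rw [smul_mul_assoc, mul_smul_comm, smul_smul, ← Int.cast_smul_eq_zsmul k, smul_smul,
    show m + 1 - 1 - r = m - r by omega]
  congr 1
  push_cast
  rw [Nat.cast_choose k (show r + 1 ≤ m + 1 by omega), show m + 1 - (r + 1) = m - r by omega]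
  have h1 : ((m + 1).factorial : k) ≠ 0 := by exact_mod_cast (m + 1).factorial_ne_zero
  have h2 : ((r + 1).factorial : k) ≠ 0 := by exact_mod_cast (r + 1).factorial_ne_zero
  have h3 : ((m - r).factorial : k) ≠ 0 := by exact_mod_cast (m - r).factorial_ne_zero
  field_simp

variable (k) in
/-- The derivative of the exponential:
`(exp U)' = exp U · ((1 - e^{-ad_U}) / ad_U) U'` for `' = h d/dh`. -/
theorem euler_sumSeries_exp [CharZero k] {U : R⟦X⟧} (hU : coeff 0 U = 0) :
    euler (sumSeries fun j => (j.factorial : k)⁻¹ • U ^ j) =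
      (sumSeries fun j => (j.factorial : k)⁻¹ • U ^ j) *
        sumSeries fun r => ((-1) ^ r / ((r + 1).factorial : k)) • adIter U r (euler U) := by
  rw [sumSeries_mul (coeff_exp_term_eq_zero k hU) (coeff_smul_adIter_eq_zero hU _ _)]
  simp only [← euler_pow_div_factorial]
  ext n
  rw [coeff_euler, sumSeries, sumSeries, coeff_mk, coeff_mk, sum_range_succ', sum_range_succ,
    smul_add, smul_sum]
  have h0 : coeff n ((((n + 1).factorial : k)⁻¹) • euler (U ^ (n + 1))) = 0 := by
    rw [coeff_smul_algebra, coeff_euler, coeff_pow_eq_zero hU (by omega), smul_zero, smul_zero]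
  have h1 : n • coeff n (((Nat.factorial 0 : k)⁻¹) • U ^ 0) = 0 := by
    have := congrArg (coeff n) (euler_one (R := R))
    simpa using this
  rw [h0, h1]
  congr 1
  refine sum_congr rfl fun j _ => ?_
  rw [coeff_smul_algebra, coeff_smul_algebra, coeff_euler, smul_comm]

/-- `dexp_U (dexp⁻¹_U Z) = Z`. -/
theorem dexp_dexpInv [CharZero k] {U : R⟦X⟧} (hU : coeff 0 U = 0) (Z : R⟦X⟧) :
    (sumSeries fun r => ((-1) ^ r / ((r + 1).factorial : k)) • adIter U r
      (sumSeries fun q => ((bernoulli' q : k) / (q.factorial : k)) • adIter U q Z)) = Z := by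
  ext n
  have hb := coeff_smul_adIter_eq_zero hU Z fun q => (bernoulli' q : k) / (q.factorial : k)
  have hr : ∀ r, ∀ j, ∀ n < j, coeff n (adIter U r
      (((bernoulli' j : k) / (j.factorial : k)) • adIter U j Z)) = 0 := fun r j n hn =>
    coeff_adIter_eq_zero hU (hb j) (by omega)
  set φ : ℕ → k := fun r => (-1) ^ r / ((r + 1).factorial : k)
  set β : ℕ → k := fun q => (bernoulli' q : k) / (q.factorial : k)
  have hterm : ∀ r, coeff n (φ r • adIter U r (sumSeries fun q => β q • adIter U q Z)) =
      ∑ q ∈ range (n + 1), (φ r * β q) • coeff n (adIter U (r + q) Z) := by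
    intro r
    rw [coeff_smul_algebra, adIter_sumSeries hU hb, coeff_sumSeries (hr r) (n.lt_succ_self),
      smul_sum]
    refine sum_congr rfl fun q _ => ?_
    rw [adIter_smul, coeff_smul_algebra, smul_smul, adIter_add]
  rw [sumSeries, coeff_mk]
  rw [sum_congr rfl fun r _ => hterm r]
  rw [sum_range_sum_range_eq (n + 1) fun r q => (φ r * β q) • coeff n (adIter U (r + q) Z)]
  · have : ∀ m ∈ range (n + 1), ∑ p ∈ antidiagonal m,
        (φ p.1 * β p.2) • coeff n (adIter U (p.1 + p.2) Z) =
          (if m = 0 then (1 : k) else 0) • coeff n (adIter U m Z) := by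
      intro m _
      rw [← sum_antidiagonal_bernoulli' m, sum_smul]
      refine sum_congr rfl fun p hp => ?_
      rw [HasAntidiagonal.mem_antidiagonal] at hp
      rw [hp]
    rw [sum_congr rfl this, sum_range_succ']
    simp [adIter_zero]
  · intro i j hij
    rw [coeff_adIter_eq_zero hU (c := 0) (by simp) (by omega), smul_zero]

end Exponential

namespace PostLieAlgebra

variable {k L : Type*} [Field k] [LieRing L] [LieAlgebra k L]

theorem expSeries_eq_sumSeries (U : (UniversalEnvelopingAlgebra k L)⟦X⟧) :
    expSeries U = sumSeries fun j => (j.factorial : k)⁻¹ • U ^ j := rfl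

theorem dexpInv_top_eq_sumSeries (U V : (UniversalEnvelopingAlgebra k L)⟦X⟧) :
    dexpInv ⊤ U V =
      sumSeries fun j => ((bernoulli' j : k) / (j.factorial : k)) • adIter U j V := by
  ext n
  simp only [dexpInv, sumSeries, coeff_mk]
  rw [filter_true_of_mem (fun _ _ => le_top)]
  rfl

/-- If `h U' = dexp⁻¹_U(Z)`, then `h (exp U)' = exp(U) Z`. -/
theorem euler_expSeries [CharZero k] {U : (UniversalEnvelopingAlgebra k L)⟦X⟧}
    (hU : coeff 0 U = 0) {Z : (UniversalEnvelopingAlgebra k L)⟦X⟧}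
    (h : euler U = dexpInv ⊤ U Z) : euler (expSeries U) = expSeries U * Z := by
  rw [expSeries_eq_sumSeries, euler_sumSeries_exp k hU, h, dexpInv_top_eq_sumSeries,
    dexp_dexpInv hU]

end PostLieAlgebra

namespace PostLieAlgebra

section Enveloping

attribute [local instance 100] LieRing.ofAssociativeRing

variable {k L : Type*} [Field k] [LieRing L] [LieAlgebra k L]

local notation "𝓤" => UniversalEnvelopingAlgebra k L
local notation "ι" => UniversalEnvelopingAlgebra.ι k

/-! ### Primitive elements and the product `*` -/

variable (k L) in
/-- The primitive elements `Δ A = A ⊗ 1 + 1 ⊗ A` of the enveloping algebra. -/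
noncomputable def primitives : Submodule k (UniversalEnvelopingAlgebra k L) :=
  LinearMap.ker ((coproduct k L).toLinearMap - (TensorProduct.mk k 𝓤 𝓤).flip 1 -
    TensorProduct.mk k 𝓤 𝓤 1)

theorem mem_primitives {A : UniversalEnvelopingAlgebra k L} :
    A ∈ primitives k L ↔ coproduct k L A = A ⊗ₜ[k] 1 + 1 ⊗ₜ[k] A := by
  simp only [primitives, LinearMap.mem_ker, LinearMap.sub_apply, AlgHom.toLinearMap_apply,
    LinearMap.flip_apply, TensorProduct.mk_apply]
  rw [sub_sub, sub_eq_zero]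

theorem ι_mem_primitives (x : L) : ι x ∈ primitives k L := mem_primitives.2 (coproduct_ι x)

theorem commutator_mem_primitives {A B : UniversalEnvelopingAlgebra k L}
    (hA : A ∈ primitives k L) (hB : B ∈ primitives k L) : A * B - B * A ∈ primitives k L := by
  rw [mem_primitives] at *
  simp only [map_sub, map_mul, hA, hB, mul_add, add_mul, Algebra.TensorProduct.tmul_mul_tmul,
    mul_one, one_mul, TensorProduct.sub_tmul, TensorProduct.tmul_sub]
  abel

variable (P : PostLieAlgebra k L)

/-- The extended product maps `𝓤(L) ⊗ L` to `L`. -/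
theorem trU_ι_mem_range (A : UniversalEnvelopingAlgebra k L) (y : L) :
    P.trU A (ι y) ∈ LinearMap.range (ι : L →ₗ⁅k⁆ UniversalEnvelopingAlgebra k L).toLinearMap := by
  -- `x A ▷ y = x ▷ (A ▷ y) - (x ▷ A) ▷ y`, so the claim is proved for all iterated derivatives
  -- of `A` at once.
  set S := LinearMap.range (ι : L →ₗ⁅k⁆ UniversalEnvelopingAlgebra k L).toLinearMap with hS
  have hder : ∀ x : L, ∀ B ∈ S, P.der x B ∈ S := by
    rintro x _ ⟨z, rfl⟩
    exact ⟨P.tr x z, (P.der_ι x z).symm⟩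
  suffices h : ∀ l : List L, P.trU (l.foldl (fun D y => P.der y D) A) (ι y) ∈ S from h []
  have fadd : ∀ (l : List L) (D E : 𝓤), l.foldl (fun D y => P.der y D) (D + E) =
      l.foldl (fun D y => P.der y D) D + l.foldl (fun D y => P.der y D) E := by
    intro l
    induction l with
    | nil => simp
    | cons y l ih => intro D E; simp only [List.foldl_cons, map_add, ih]
  have fsmul : ∀ (l : List L) (c : k) (D : 𝓤), l.foldl (fun D y => P.der y D) (c • D) =
      c • l.foldl (fun D y => P.der y D) D := by
    intro l
    induction l with
    | nil => simp
    | cons y l ih => intro c D; simp only [List.foldl_cons, map_smul, ih]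
  induction A using env_induction with
  | h1 =>
    intro l
    cases l with
    | nil => exact ⟨y, by simp [trU_one]⟩
    | cons z l =>
      have h0 : l.foldl (fun D y => P.der y D) (0 : 𝓤) = 0 := by simpa using fsmul l 0 0
      simp [h0]
  | hmul x A h =>
    intro l
    induction l generalizing x A with
    | nil =>
      have h1 := h [x]
      simp only [List.foldl_nil, List.foldl_cons] at h1 ⊢
      rw [trU_ι_mul]
      exact S.sub_mem (hder x _ (h [])) h1
    | cons z l ih =>
      simp only [List.foldl_cons, der_mul, der_ι, fadd, map_add, LinearMap.add_apply]
      exact S.add_mem (ih (P.tr z x) A h) (ih x (P.der z A) fun m => h (z :: m))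
  | hadd A D hA hD =>
    intro l
    simp only [fadd, map_add, LinearMap.add_apply]
    exact S.add_mem (hA l) (hD l)
  | hsmul c A hA =>
    intro l
    simp only [fsmul, map_smul, LinearMap.smul_apply]
    exact S.smul_mem c (hA l)

theorem trU_ι_mem_primitives (A : UniversalEnvelopingAlgebra k L) (y : L) :
    P.trU A (ι y) ∈ primitives k L := by
  obtain ⟨z, hz⟩ := P.trU_ι_mem_range A y
  rw [← hz]
  exact ι_mem_primitives z

theorem star_apply (A B : UniversalEnvelopingAlgebra k L) :
    P.star A B = LinearMap.mul' k _
      (TensorProduct.map LinearMap.id (P.trU.flip B) (coproduct k L A)) := rfl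

theorem star_one_left (B : UniversalEnvelopingAlgebra k L) : P.star 1 B = B := by
  simp [star_apply, Algebra.TensorProduct.one_def, trU_one]

theorem star_ι (x : L) (B : UniversalEnvelopingAlgebra k L) :
    P.star (ι x) B = ι x * B + P.der x B := by
  rw [star_apply, coproduct_ι]
  simp only [map_add, TensorProduct.map_tmul, LinearMap.id_apply, LinearMap.mul'_apply,
    LinearMap.flip_apply, trU_one, trU_ι, one_mul]

/-- `(x A + x ▷ A) * B = x (A * B) + x ▷ (A * B)`. -/
theorem star_ι_mul_add_der (x : L) (A B : UniversalEnvelopingAlgebra k L) :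
    P.star (ι x * A + P.der x A) B = ι x * P.star A B + P.der x (P.star A B) := by
  rw [star_apply, star_apply, map_add (coproduct k L), map_mul, coproduct_ι, coproduct_der]
  induction coproduct k L A using TensorProduct.induction_on with
  | zero => simp
  | tmul a b =>
    simp only [add_mul, Algebra.TensorProduct.tmul_mul_tmul, TensorProduct.map_tmul,
      LinearMap.id_apply, one_mul, map_add, LinearMap.mul'_apply, LinearMap.flip_apply,
      trU_ι_mul, der_mul]
    noncomm_ring
  | add a b ha hb =>
    simp only [mul_add, map_add] at ha hb ⊢
    have h := congrArg₂ (· + ·) ha hb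
    convert h using 1 <;> abel

/-- Associativity of `*` with a first factor in `L`. -/
theorem star_ι_star (x : L) (A B : UniversalEnvelopingAlgebra k L) :
    P.star (ι x) (P.star A B) = P.star (P.star (ι x) A) B := by
  rw [star_ι, star_ι, star_ι_mul_add_der]

/-- The powers `f * (f * ⋯ )` of an element of `L`. -/
noncomputable def starPowι (f : L) : ℕ → UniversalEnvelopingAlgebra k L
  | 0 => 1
  | n + 1 => P.star (ι f) (starPowι f n)

theorem starPowι_star (f : L) (n : ℕ) : P.star (P.starPowι f n) (ι f) = P.starPowι f (n + 1) := by
  induction n with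
  | zero => simp only [starPowι, star_one_left, star_ι, mul_one, der_one, add_zero]
  | succ n ih => rw [starPowι, ← star_ι_star, ih, ← starPowι]

/-! ### Series in the step size -/

section Step

variable (m : UniversalEnvelopingAlgebra k L →ₗ[k] UniversalEnvelopingAlgebra k L →ₗ[k]
  UniversalEnvelopingAlgebra k L) (α : (UniversalEnvelopingAlgebra k L)⟦X⟧) (f : L)

theorem coeff_stepSeries (n : ℕ) : coeff n (stepSeries k f) = if n = 1 then ι f else 0 :=
  coeff_monomial _ _ _

theorem coeff_extendSeries (β : (UniversalEnvelopingAlgebra k L)⟦X⟧) (n : ℕ) :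
    coeff n (extendSeries m α β) = ∑ p ∈ antidiagonal n, m (coeff p.1 α) (coeff p.2 β) :=
  coeff_mk _ _

theorem coeff_zero_extendSeries_step : coeff 0 (extendSeries m α (stepSeries k f)) = 0 := by
  rw [coeff_extendSeries, Nat.antidiagonal_zero, sum_singleton, coeff_stepSeries,
    if_neg (by simp)]
  simp

theorem coeff_succ_extendSeries_step (n : ℕ) :
    coeff (n + 1) (extendSeries m α (stepSeries k f)) = m (coeff n α) (ι f) := by
  rw [coeff_extendSeries, sum_eq_single (n, 1)]
  · simp only [coeff_stepSeries, if_true]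
  · rintro ⟨i, j⟩ hp hne
    rw [HasAntidiagonal.mem_antidiagonal] at hp
    have : j ≠ 1 := fun h => hne (by rw [Prod.mk.injEq]; simp only at hp; omega)
    simp only [coeff_stepSeries, if_neg this, map_zero]
  · intro h
    exact (h (HasAntidiagonal.mem_antidiagonal.2 rfl)).elim

theorem coeff_zero_extendSeries_step_left : coeff 0 (extendSeries m (stepSeries k f) α) = 0 := by
  rw [coeff_extendSeries, Nat.antidiagonal_zero, sum_singleton, coeff_stepSeries,
    if_neg (by simp)]
  simp

theorem coeff_succ_extendSeries_step_left (n : ℕ) :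
    coeff (n + 1) (extendSeries m (stepSeries k f) α) = m (ι f) (coeff n α) := by
  rw [coeff_extendSeries, sum_eq_single (1, n)]
  · simp only [coeff_stepSeries, if_true]
  · rintro ⟨i, j⟩ hp hne
    rw [HasAntidiagonal.mem_antidiagonal] at hp
    have : i ≠ 1 := fun h => hne (by rw [Prod.mk.injEq]; simp only at hp; omega)
    simp only [coeff_stepSeries, if_neg this, map_zero, LinearMap.zero_apply]
  · intro h
    exact (h (HasAntidiagonal.mem_antidiagonal.2 (add_comm 1 n))).elim

end Step

theorem coeff_starPow_step (f : L) (j n : ℕ) :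
    coeff n (P.starPow (stepSeries k f) j) = if n = j then P.starPowι f j else 0 := by
  induction j generalizing n with
  | zero => simp [starPow, starPowι, coeff_one]
  | succ j ih =>
    rw [starPow]
    cases n with
    | zero => rw [coeff_zero_extendSeries_step_left]; simp
    | succ n =>
      rw [coeff_succ_extendSeries_step_left, ih]
      split_ifs with h1 h2 h2
      · rw [starPowι]
      · omega
      · omega
      · simp

theorem coeff_expStarSeries_step (f : L) (n : ℕ) :
    coeff n (P.expStarSeries (stepSeries k f)) = (n.factorial : k)⁻¹ • P.starPowι f n := by
  rw [expStarSeries, coeff_mk, sum_eq_single n]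
  · rw [coeff_starPow_step, if_pos rfl]
  · intro j _ hj
    rw [coeff_starPow_step, if_neg (Ne.symm hj), smul_zero]
  · simp

/-- A solution of the linear equation `h Y' = Y Z` with primitive `Z` and `Y(0) = 1` is grouplike:
`Δ Y` and `Y ⊗ Y` solve the same linear equation in `𝓤(L) ⊗ 𝓤(L)`. -/
theorem coproduct_coeff_of_euler_eq [CharZero k] {Y Z : (UniversalEnvelopingAlgebra k L)⟦X⟧}
    (hY0 : coeff 0 Y = 1) (hZ0 : coeff 0 Z = 0) (hZ : ∀ n, coeff n Z ∈ primitives k L)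
    (hY : euler Y = Y * Z) (n : ℕ) :
    coproduct k L (coeff n Y) = ∑ p ∈ antidiagonal n, coeff p.1 Y ⊗ₜ[k] coeff p.2 Y := by
  let i₁ : 𝓤 →+* 𝓤 ⊗[k] 𝓤 :=
    (Algebra.TensorProduct.includeLeft : 𝓤 →ₐ[k] 𝓤 ⊗[k] 𝓤).toRingHom
  let i₂ : 𝓤 →+* 𝓤 ⊗[k] 𝓤 :=
    (Algebra.TensorProduct.includeRight : 𝓤 →ₐ[k] 𝓤 ⊗[k] 𝓤).toRingHom
  have hi₁ : ∀ A, i₁ A = A ⊗ₜ[k] 1 := fun _ => rfl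
  have hi₂ : ∀ A, i₂ A = 1 ⊗ₜ[k] A := fun _ => rfl
  have hmap : ∀ (g : 𝓤 →+* 𝓤 ⊗[k] 𝓤) (α : 𝓤⟦X⟧), euler (map g α) = map g (euler α) := by
    intro g α
    ext n
    rw [coeff_euler, coeff_map, coeff_map, coeff_euler, map_nsmul]
  let Δ : 𝓤 →+* 𝓤 ⊗[k] 𝓤 := (coproduct k L).toRingHom
  have hΔZ : map Δ Z = map i₁ Z + map i₂ Z := by
    ext n
    rw [map_add, coeff_map, coeff_map, coeff_map]
    exact mem_primitives.1 (hZ n)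
  have hcomm : ∀ α β : 𝓤⟦X⟧, map i₁ α * map i₂ β = map i₂ β * map i₁ α := by
    intro α β
    ext n
    rw [coeff_mul, coeff_mul, ← Nat.sum_antidiagonal_swap]
    refine sum_congr rfl fun p _ => ?_
    simp only [Prod.swap, coeff_map, hi₁, hi₂, Algebra.TensorProduct.tmul_mul_tmul, mul_one,
      one_mul]
  have hG : euler (map Δ Y) = map Δ Y * map Δ Z := by rw [hmap, hY, map_mul]
  have hH : euler (map i₁ Y * map i₂ Y) = map i₁ Y * map i₂ Y * map Δ Z := by
    rw [euler_mul, hmap, hmap, hY, map_mul, map_mul, hΔZ, mul_add, mul_assoc (map i₁ Y),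
      hcomm Z Y, ← mul_assoc, ← mul_assoc]
  have huniq : ∀ n, coeff n (map Δ Y) = coeff n (map i₁ Y * map i₂ Y) := by
    intro n
    induction n using Nat.strong_induction_on with
    | _ n ih =>
      rcases Nat.eq_zero_or_pos n with rfl | hn
      · rw [coeff_map, coeff_mul]
        simp only [HasAntidiagonal.antidiagonal_zero, sum_singleton, coeff_map, hY0, map_one, mul_one]
      · have h1 := congrArg (coeff n) hG
        have h2 := congrArg (coeff n) hH
        rw [coeff_euler, coeff_mul] at h1
        rw [coeff_euler, coeff_mul (φ := map i₁ Y * map i₂ Y)] at h2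
        have h3 : n • coeff n (map Δ Y) = n • coeff n (map i₁ Y * map i₂ Y) := by
          rw [h1, h2]
          refine sum_congr rfl fun p hp => ?_
          rw [HasAntidiagonal.mem_antidiagonal] at hp
          by_cases hp2 : p.2 = 0
          · rw [hp2, show coeff 0 (map Δ Z) = 0 by rw [coeff_map, hZ0, map_zero], mul_zero, mul_zero]
          · rw [ih p.1 (by omega)]
        rw [← Nat.cast_smul_eq_nsmul k, ← Nat.cast_smul_eq_nsmul k] at h3
        have hn' : (n : k) ≠ 0 := by exact_mod_cast hn.ne'
        exact (smul_right_injective _ hn') h3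
  have h := huniq n
  rw [coeff_map, coeff_mul] at h
  simp only [coeff_map, hi₁, hi₂, Algebra.TensorProduct.tmul_mul_tmul, mul_one, one_mul] at h
  exact h

/-- The Lie-Butcher flow equation: `h Y' = Y (Y ▷ h f)` and `Y(0) = 1` characterise
`Y = exp*(h f)`. For grouplike `Y` the right-hand side is `Y * h f`. -/
theorem eq_expStarSeries_of_euler_eq [CharZero k] (f : L)
    {Y : (UniversalEnvelopingAlgebra k L)⟦X⟧} (hY0 : coeff 0 Y = 1)
    (hY : euler Y = Y * extendSeries P.trU Y (stepSeries k f)) :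
    Y = P.expStarSeries (stepSeries k f) := by
  have hZ0 := coeff_zero_extendSeries_step P.trU Y f
  have hZ : ∀ n, coeff n (extendSeries P.trU Y (stepSeries k f)) ∈ primitives k L := by
    intro n
    cases n with
    | zero => rw [hZ0]; exact Submodule.zero_mem _
    | succ n => rw [coeff_succ_extendSeries_step]; exact P.trU_ι_mem_primitives _ _
  have hrec : ∀ n, (n + 1) • coeff (n + 1) Y = P.star (coeff n Y) (ι f) := by
    intro n
    have h := congrArg (coeff (n + 1)) hY
    rw [coeff_euler, coeff_mul, Nat.sum_antidiagonal_succ', hZ0, mul_zero, zero_add] at h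
    rw [h, star_apply, coproduct_coeff_of_euler_eq hY0 hZ0 hZ hY, map_sum, map_sum]
    refine sum_congr rfl fun p _ => ?_
    rw [coeff_succ_extendSeries_step]
    simp
  ext n
  rw [coeff_expStarSeries_step]
  induction n with
  | zero => simp [hY0, starPowι]
  | succ n ih =>
    have h := hrec n
    rw [ih, map_smul, LinearMap.smul_apply, starPowι_star, ← Nat.cast_smul_eq_nsmul k] at h
    have hn : ((n + 1 : ℕ) : k) ≠ 0 := by exact_mod_cast n.succ_ne_zero
    rw [← inv_smul_smul₀ hn (coeff (n + 1) Y), h, smul_smul, Nat.factorial_succ, Nat.cast_mul,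
      mul_inv]

end Enveloping

end PostLieAlgebra

/-! ### Elementary weights of forests -/

namespace ButcherTree

variable {k : Type*} [Field k] {s : ℕ} (a : Matrix (Fin s) (Fin s) k)

/-- The elementary weights of a tree: the weight `∑ⱼ aᵢⱼ Φⱼ(τ)` of the internal stage `i` at
`some i`, and the weight `1 / τ!` of the exact solution at `none`. -/
def weight (τ : ButcherTree) : Option (Fin s) → k
  | some i => ∑ j, a i j * stageWeight a τ j
  | none => (τ.factorial : k)⁻¹

theorem stageWeight_node (ts : List ButcherTree) (i : Fin s) :
    stageWeight a (node ts) i = (ts.map fun τ => weight a τ (some i)).prod := by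
  rw [stageWeight]
  rfl

theorem order_node (ts : List ButcherTree) : (node ts).order = (ts.map order).sum + 1 := by
  rw [order, add_comm]

theorem inv_factorial_node (ts : List ButcherTree) :
    ((node ts).factorial : k)⁻¹ =
      ((node ts).order : k)⁻¹ * (ts.map fun τ => weight a τ none).prod := by
  rw [factorial, Nat.cast_mul, mul_inv, Nat.cast_list_prod]
  congr 1
  induction ts with
  | nil => simp
  | cons τ ts ih =>
    simp only [List.map_cons, List.prod_cons, mul_inv] at ih ⊢
    rw [ih]
    rfl

variable (M : Type*) [AddCommGroup M] [Module k M]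

/-- The tuples spanned by `i ↦ (∏_{τ ∈ ts} weight τ i) • A` for the forests `ts` with `n - c`
vertices and the vectors `A`. Membership for `c = 0` is the shape of the coefficient of `hⁿ` in the
B-series of a tuple of internal stages and exact solution; `c = 1` accounts for one additional
factor `h`. -/
def forestSpan (c n : ℕ) : Submodule k (Option (Fin s) → M) :=
  Submodule.span k {v | ∃ (ts : List ButcherTree) (A : M),
    (ts.map order).sum + c = n ∧ v = fun i => (ts.map fun τ => weight a τ i).prod • A}

variable {M}

theorem const_mem_forestSpan (A : M) : (fun _ => A) ∈ forestSpan a M 0 0 :=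
  Submodule.subset_span ⟨[], A, by simp, by simp⟩

theorem map_mem_forestSpan (g : M →ₗ[k] M) {c n : ℕ} {v : Option (Fin s) → M}
    (hv : v ∈ forestSpan a M c n) (d : ℕ) : (fun i => g (v i)) ∈ forestSpan a M (c + d) (n + d) := by
  induction hv using Submodule.span_induction with
  | mem v h =>
    obtain ⟨ts, A, hn, rfl⟩ := h
    exact Submodule.subset_span ⟨ts, g A, by omega, by simp⟩
  | zero => simp only [Pi.zero_apply, map_zero]; exact Submodule.zero_mem _
  | add v w _ _ hv hw => simp only [Pi.add_apply, map_add]; exact Submodule.add_mem _ hv hw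
  | smul r v _ hv => simp only [Pi.smul_apply, map_smul]; exact Submodule.smul_mem _ r hv

/-- The product of the weights of two forests is the weight of their union. -/
theorem bilin_mem_forestSpan (m : M →ₗ[k] M →ₗ[k] M) {c d n n' : ℕ} {v w : Option (Fin s) → M}
    (hv : v ∈ forestSpan a M c n) (hw : w ∈ forestSpan a M d n') :
    (fun i => m (v i) (w i)) ∈ forestSpan a M (c + d) (n + n') := by
  induction hv using Submodule.span_induction with
  | mem v h =>
    obtain ⟨ts, A, hn, rfl⟩ := h
    induction hw using Submodule.span_induction with
    | mem w h =>
      obtain ⟨ts', A', hn', rfl⟩ := h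
      refine Submodule.subset_span ⟨ts ++ ts', m A A', ?_, ?_⟩
      · rw [List.map_append, List.sum_append]; omega
      · funext i
        rw [List.map_append, List.prod_append, map_smul, map_smul, LinearMap.smul_apply,
          smul_smul, mul_comm]
    | zero => simp only [Pi.zero_apply, map_zero]; exact Submodule.zero_mem _
    | add v w _ _ hv hw => simp only [Pi.add_apply, map_add]; exact Submodule.add_mem _ hv hw
    | smul r v _ hv =>
      convert Submodule.smul_mem _ r hv using 1
      funext i
      exact (m _).map_smul r _
  | zero =>
    simp only [Pi.zero_apply, map_zero, LinearMap.zero_apply]; exact Submodule.zero_mem _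
  | add v w _ _ hv hw =>
    simp only [Pi.add_apply, map_add, LinearMap.add_apply]; exact Submodule.add_mem _ hv hw
  | smul r v _ hv =>
    simp only [Pi.smul_apply, map_smul, LinearMap.smul_apply]; exact Submodule.smul_mem _ r hv

/-- Passing from the derivatives of the stages to the stages and integrating the exact solution
joins the trees of a forest to a new root. -/
theorem graft_mem_forestSpan {n : ℕ} {v w : Option (Fin s) → M} (hv : v ∈ forestSpan a M 1 n)
    (hsome : ∀ i, w (some i) = ∑ j, a i j • v (some j)) (hnone : w none = (n : k)⁻¹ • v none) :
    w ∈ forestSpan a M 0 n := by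
  obtain rfl : w = fun i => i.elim ((n : k)⁻¹ • v none) fun i => ∑ j, a i j • v (some j) := by
    funext i
    cases i with
    | none => exact hnone
    | some i => exact hsome i
  clear hsome hnone
  induction hv using Submodule.span_induction with
  | mem v h =>
    obtain ⟨ts, A, hn, rfl⟩ := h
    refine Submodule.subset_span ⟨[node ts], A, by simp [order_node, hn], ?_⟩
    funext i
    cases i with
    | none =>
      simp only [Option.elim, List.map_cons, List.map_nil, List.prod_singleton, weight]
      rw [inv_factorial_node a, smul_smul, order_node, hn]
      rfl
    | some i =>
      simp only [Option.elim, List.map_cons, List.map_nil, List.prod_singleton, weight]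
      rw [sum_smul]
      refine sum_congr rfl fun j _ => ?_
      rw [stageWeight_node, smul_smul]
      rfl
  | zero =>
    convert Submodule.zero_mem _ using 1
    funext i
    cases i <;> simp
  | add v w _ _ hv hw =>
    convert Submodule.add_mem _ hv hw using 1
    funext i
    cases i <;> simp [smul_add, sum_add_distrib]
  | smul r v _ hv =>
    convert Submodule.smul_mem _ r hv using 1
    funext i
    cases i with
    | none => simp [smul_comm r]
    | some i => simp only [Option.elim, Pi.smul_apply, smul_sum, smul_comm r]

/-- The order conditions say that the numerical and the exact solution have equal coefficients. -/
theorem sum_smul_eq_of_mem_forestSpan {b : Fin s → k} {p : ℕ} (hab : ButcherOrderConditions a b p)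
    {n : ℕ} (hn : n ≤ p) {v : Option (Fin s) → M} (hv : v ∈ forestSpan a M 1 n) :
    ∑ i, b i • v (some i) = (n : k)⁻¹ • v none := by
  induction hv using Submodule.span_induction with
  | mem v h =>
    obtain ⟨ts, A, hts, rfl⟩ := h
    have ho : (node ts).order = n := by rw [order_node, hts]
    have h := hab (node ts) (by omega)
    rw [one_div, inv_factorial_node a, ho] at h
    simp only [smul_smul]
    rw [← h, ← sum_smul]
    simp only [stageWeight_node]
  | zero => simp
  | add v w _ _ hv hw => simp only [Pi.add_apply, smul_add, sum_add_distrib, hv, hw]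
  | smul r v _ hv =>
    simp only [Pi.smul_apply, smul_comm _ r, ← smul_sum, hv]

end ButcherTree

/-! ### Locality of the series operations -/

section Locality

variable {R : Type*} [Ring R] {x y V W : R⟦X⟧} {n : ℕ}

theorem coeff_mul_congr (h : ∀ m < n, coeff m x = coeff m y)
    (h' : ∀ m < n, coeff m V = coeff m W) : ∀ m < n, coeff m (x * V) = coeff m (y * W) := by
  intro m hm
  rw [coeff_mul, coeff_mul]
  refine sum_congr rfl fun p hp => ?_
  rw [HasAntidiagonal.mem_antidiagonal] at hp
  rw [h _ (by omega), h' _ (by omega)]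

theorem coeff_pow_congr (h : ∀ m < n, coeff m x = coeff m y) (j : ℕ) :
    ∀ m < n, coeff m (x ^ j) = coeff m (y ^ j) := by
  induction j with
  | zero => simp
  | succ j ih => rw [pow_succ, pow_succ]; exact coeff_mul_congr ih h

theorem coeff_zero_adIter (x : R⟦X⟧) (hV : coeff 0 V = 0) (j : ℕ) :
    coeff 0 (adIter x j V) = 0 := by
  induction j with
  | zero => exact hV
  | succ j ih => rw [adIter_succ, map_sub]; simp [coeff_mul, ih]

/-- If `V` and `W` have no constant term, then the coefficient of `hⁿ` in `ad_x V` involves only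
coefficients of `x` below degree `n`. -/
theorem coeff_adIter_congr (h : ∀ m < n, coeff m x = coeff m y)
    (hV : coeff 0 V = 0) (hW : coeff 0 W = 0)
    (h' : ∀ m < n + 1, coeff m V = coeff m W) (j : ℕ) :
    ∀ m < n + 1, coeff m (adIter x j V) = coeff m (adIter y j W) := by
  induction j with
  | zero => exact h'
  | succ j ih =>
    intro m hm
    rw [adIter_succ, adIter_succ, map_sub, map_sub]
    have hV0 := coeff_zero_adIter x hV j
    have hW0 := coeff_zero_adIter y hW j
    congr 1
    · rw [coeff_mul, coeff_mul]
      refine sum_congr rfl fun p hp => ?_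
      rw [HasAntidiagonal.mem_antidiagonal] at hp
      by_cases hp2 : p.2 = 0
      · rw [hp2, hV0, hW0, mul_zero, mul_zero]
      · rw [h _ (by omega), ih _ (by omega)]
    · rw [coeff_mul, coeff_mul]
      refine sum_congr rfl fun p hp => ?_
      rw [HasAntidiagonal.mem_antidiagonal] at hp
      by_cases hp1 : p.1 = 0
      · rw [hp1, hV0, hW0, zero_mul, zero_mul]
      · rw [h _ (by omega), ih _ (by omega)]

end Locality

namespace PostLieAlgebra

variable {k L : Type*} [Field k] [LieRing L] [LieAlgebra k L]

local notation "𝓤" => UniversalEnvelopingAlgebra k L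

theorem coeff_expSeries_congr {x y : 𝓤⟦X⟧} {n : ℕ} (h : ∀ m < n, coeff m x = coeff m y) :
    ∀ m < n, coeff m (expSeries x) = coeff m (expSeries y) := by
  intro m hm
  rw [expSeries, expSeries, coeff_mk, coeff_mk]
  exact sum_congr rfl fun j _ => by rw [coeff_pow_congr h j m hm]

theorem coeff_zero_expSeries (x : 𝓤⟦X⟧) : coeff 0 (expSeries x) = 1 := by
  rw [expSeries, coeff_mk, sum_range_one]
  simp

theorem coeff_dexpInv (N : ℕ∞) (U V : 𝓤⟦X⟧) (n : ℕ) : coeff n (dexpInv N U V) =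
    ∑ j ∈ (range (n + 1)).filter (fun j : ℕ => (j : ℕ∞) ≤ N),
      ((bernoulli' j : k) / (j.factorial : k)) • coeff n (adIter U j V) :=
  coeff_mk _ _

/-- The truncation of `dexp⁻¹_U(V)` at `N` does not affect the coefficients up to `h ^ (N + 1)`. -/
theorem coeff_dexpInv_of_le {N : ℕ∞} {U V : 𝓤⟦X⟧} (hU : coeff 0 U = 0) (hV : coeff 0 V = 0)
    {n : ℕ} (hn : (n : ℕ∞) ≤ N + 1) : coeff n (dexpInv N U V) =
      ∑ j ∈ range n, ((bernoulli' j : k) / (j.factorial : k)) • coeff n (adIter U j V) := by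
  rw [coeff_dexpInv]
  symm
  refine sum_subset (fun j hj => ?_) fun j hj hj' => ?_
  · rw [mem_range] at hj
    rw [mem_filter, mem_range]
    refine ⟨by omega, ?_⟩
    have h : ((j + 1 : ℕ) : ℕ∞) ≤ N + 1 := le_trans (by exact_mod_cast hj) hn
    rw [Nat.cast_add, Nat.cast_one] at h
    exact (ENat.add_le_add_iff_right ENat.one_ne_top).1 h
  · rw [mem_range] at hj'
    rw [coeff_adIter_eq_zero hU (c := 1) (fun m hm => by
      obtain rfl : m = 0 := by omega
      exact hV) (by omega), smul_zero]

variable (P : PostLieAlgebra k L)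

/-- The right-hand side `U ↦ dexp⁻¹_U(exp(U) ▷ h f)` of the stage equations and of the differential
equation on the Lie algebra. -/
noncomputable def stageMap (N : ℕ∞) (f : L) (U : (UniversalEnvelopingAlgebra k L)⟦X⟧) :
    (UniversalEnvelopingAlgebra k L)⟦X⟧ :=
  dexpInv N U (extendSeries P.trU (expSeries U) (stepSeries k f))

theorem coeff_zero_stageMap (N : ℕ∞) (f : L) (U : 𝓤⟦X⟧) : coeff 0 (P.stageMap N f U) = 0 := by
  rw [stageMap, coeff_dexpInv]
  refine sum_eq_zero fun j _ => ?_
  rw [coeff_zero_adIter U (coeff_zero_extendSeries_step _ _ f), smul_zero]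

theorem coeff_stageMap_congr (N : ℕ∞) (f : L) {x y : 𝓤⟦X⟧} {n : ℕ}
    (h : ∀ m < n, coeff m x = coeff m y) :
    ∀ m < n + 1, coeff m (P.stageMap N f x) = coeff m (P.stageMap N f y) := by
  intro m hm
  rw [stageMap, stageMap, coeff_dexpInv, coeff_dexpInv]
  refine sum_congr rfl fun j _ => ?_
  rw [coeff_adIter_congr h (coeff_zero_extendSeries_step _ _ f)
    (coeff_zero_extendSeries_step _ _ f) ?_ j m hm]
  intro m hm
  cases m with
  | zero => rw [coeff_zero_extendSeries_step, coeff_zero_extendSeries_step]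
  | succ m =>
    rw [coeff_succ_extendSeries_step, coeff_succ_extendSeries_step,
      coeff_expSeries_congr h m (by omega)]

theorem coeff_stageMap_mem_primitives (N : ℕ∞) (f : L) {x : 𝓤⟦X⟧}
    (hx : ∀ n, coeff n x ∈ primitives k L) (n : ℕ) :
    coeff n (P.stageMap N f x) ∈ primitives k L := by
  have h : ∀ j n, coeff n (adIter x j (extendSeries P.trU (expSeries x) (stepSeries k f))) ∈
      primitives k L := by
    intro j
    induction j with
    | zero =>
      intro n
      rw [adIter_zero]
      cases n with
      | zero => rw [coeff_zero_extendSeries_step]; exact Submodule.zero_mem _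
      | succ n => rw [coeff_succ_extendSeries_step]; exact P.trU_ι_mem_primitives _ _
    | succ j ih =>
      intro n
      rw [adIter_succ, map_sub, coeff_mul, coeff_mul, ← Nat.sum_antidiagonal_swap (n := n),
        ← sum_sub_distrib]
      exact Submodule.sum_mem _ fun p _ => commutator_mem_primitives (hx _) (ih _)
  rw [stageMap, coeff_dexpInv]
  exact Submodule.sum_mem _ fun j _ => Submodule.smul_mem _ _ (h j n)

variable {s : ℕ} (a : Matrix (Fin s) (Fin s) k)

theorem coeff_sum_smul {ι : Type*} (t : Finset ι) (c : ι → k) (K : ι → 𝓤⟦X⟧) (n : ℕ) :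
    coeff n (∑ j ∈ t, c j • K j) = ∑ j ∈ t, c j • coeff n (K j) := by
  rw [map_sum]
  rfl

/-! ### Existence and uniqueness of the stages -/

theorem isContraction_stages (N : ℕ∞) (f : L) :
    IsContraction fun (K : Fin s → 𝓤⟦X⟧) i => P.stageMap N f (∑ j, a i j • K j) := by
  intro n K K' h i
  refine P.coeff_stageMap_congr N f fun m hm => ?_
  rw [coeff_sum_smul, coeff_sum_smul]
  exact sum_congr rfl fun j _ => by rw [h j m hm]

theorem isRKMKStages_iff (N : ℕ∞) (f : L) (K : Fin s → 𝓤⟦X⟧) :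
    P.IsRKMKStages N a (stepSeries k f) K ↔
      (fun i => P.stageMap N f (∑ j, a i j • K j)) = K := by
  constructor
  · intro h
    funext i
    exact (h i).2.symm
  · intro h i
    have hK : K i = P.stageMap N f (∑ j, a i j • K j) := (congrFun h i).symm
    refine ⟨⟨by rw [hK, coeff_zero_stageMap], fun n => ?_⟩, hK⟩
    refine mem_primitives.1 ?_
    refine (P.isContraction_stages a N f).fixedPoint_induction
      (fun _ v => ∀ i, v i ∈ primitives k L) (fun _ _ => Submodule.zero_mem _) ?_ h n i
    intro x hx n i
    refine P.coeff_stageMap_mem_primitives N f (fun m => ?_) n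
    rw [coeff_sum_smul]
    exact Submodule.sum_mem _ fun j _ => Submodule.smul_mem _ _ (hx m j)

theorem existsUnique_isRKMKStages (N : ℕ∞) (f : L) :
    ∃! K : Fin s → 𝓤⟦X⟧, P.IsRKMKStages N a (stepSeries k f) K := by
  simp only [isRKMKStages_iff]
  exact (P.isContraction_stages a N f).existsUnique_fixedPoint

/-! ### The joint system of the internal stages and the exact solution -/

/-- The truncation used in the joint system: stage equations are truncated at `N`, the exact
equation is not. -/
def jointTrunc (N : ℕ∞) : Option (Fin s) → ℕ∞
  | some _ => N
  | none => ⊤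

/-- The joint system for the internal stages `Uᵢ = ∑ⱼ aᵢⱼ dexp⁻¹(⋯)` and the exact solution `u` of
`h u' = dexp⁻¹_u(exp(u) ▷ h f)`. The latter is integrated by dividing the coefficient of `hⁿ` by
`n`; the constant coefficient of the right-hand side is zero, so nothing is lost at `n = 0`. -/
noncomputable def jointMap (N : ℕ∞) (f : L)
    (x : Option (Fin s) → (UniversalEnvelopingAlgebra k L)⟦X⟧) :
    Option (Fin s) → (UniversalEnvelopingAlgebra k L)⟦X⟧
  | some i => ∑ j, a i j • P.stageMap N f (x (some j))
  | none => PowerSeries.mk fun n => (n : k)⁻¹ • coeff n (P.stageMap ⊤ f (x none))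

theorem isContraction_jointMap (N : ℕ∞) (f : L) : IsContraction (P.jointMap a N f) := by
  intro n x y h i m hm
  cases i with
  | none =>
    rw [jointMap, jointMap, coeff_mk, coeff_mk, P.coeff_stageMap_congr ⊤ f (h none) m hm]
  | some i =>
    rw [jointMap, jointMap, coeff_sum_smul, coeff_sum_smul]
    exact sum_congr rfl fun j _ => by rw [P.coeff_stageMap_congr N f (h (some j)) m hm]

/-- The fixed point equation forces `Uᵢ(0) = 0` and `u(0) = 0`. -/
theorem coeff_zero_jointMap (N : ℕ∞) (f : L) (x : Option (Fin s) → 𝓤⟦X⟧) (i : Option (Fin s)) :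
    coeff 0 (P.jointMap a N f x i) = 0 := by
  cases i with
  | none => rw [jointMap, coeff_mk, coeff_zero_stageMap, smul_zero]
  | some i =>
    rw [jointMap, coeff_sum_smul]
    exact sum_eq_zero fun j _ => by rw [coeff_zero_stageMap, smul_zero]

open ButcherTree in
theorem coeff_mul_mem_forestSpan {x V : Option (Fin s) → 𝓤⟦X⟧} {c d p : ℕ}
    (hx : ∀ n ≤ p, (fun i => coeff n (x i)) ∈ forestSpan a 𝓤 c n)
    (hV : ∀ n ≤ p, (fun i => coeff n (V i)) ∈ forestSpan a 𝓤 d n) :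
    ∀ n ≤ p, (fun i => coeff n (x i * V i)) ∈ forestSpan a 𝓤 (c + d) n := by
  intro n hn
  have e : (fun i => coeff n (x i * V i)) =
      ∑ q ∈ antidiagonal n, fun i => LinearMap.mul k 𝓤 (coeff q.1 (x i)) (coeff q.2 (V i)) := by
    funext i
    rw [coeff_mul, Finset.sum_apply]
    rfl
  rw [e]
  refine Submodule.sum_mem _ fun q hq => ?_
  rw [HasAntidiagonal.mem_antidiagonal] at hq
  rw [← hq]
  exact bilin_mem_forestSpan a _ (hx _ (by omega)) (hV _ (by omega))

open ButcherTree in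
/-- If the stages are B-series up to degree `p`, so are their derivatives. -/
theorem coeff_stageMap_mem_forestSpan {p : ℕ} {N : ℕ∞} (hN : (p : ℕ∞) ≤ N + 1) (f : L)
    {x : Option (Fin s) → 𝓤⟦X⟧} (hx0 : ∀ i, coeff 0 (x i) = 0)
    (hx : ∀ n ≤ p, (fun i => coeff n (x i)) ∈ forestSpan a 𝓤 0 n) :
    ∀ n ≤ p, (fun i => coeff n (P.stageMap (jointTrunc N i) f (x i))) ∈ forestSpan a 𝓤 1 n := by
  have hpow : ∀ j, ∀ n ≤ p, (fun i => coeff n (x i ^ j)) ∈ forestSpan a 𝓤 0 n := by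
    intro j
    induction j with
    | zero =>
      intro n _
      simp only [pow_zero, coeff_one]
      split_ifs with h
      · rw [h]; exact const_mem_forestSpan a 1
      · exact Submodule.zero_mem _
    | succ j ih =>
      intro n hn
      have h := coeff_mul_mem_forestSpan a ih hx n hn
      rw [add_zero] at h
      simpa only [pow_succ] using h
  have hexp : ∀ n ≤ p, (fun i => coeff n (expSeries (x i))) ∈ forestSpan a 𝓤 0 n := by
    intro n hn
    have e : (fun i => coeff n (expSeries (x i))) =
        ∑ j ∈ range (n + 1), (j.factorial : k)⁻¹ • fun i => coeff n (x i ^ j) := by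
      funext i
      rw [expSeries, coeff_mk, Finset.sum_apply]
      rfl
    rw [e]
    exact Submodule.sum_mem _ fun j _ => Submodule.smul_mem _ _ (hpow j n hn)
  have hV : ∀ n ≤ p, (fun i => coeff n (extendSeries P.trU (expSeries (x i)) (stepSeries k f))) ∈
      forestSpan a 𝓤 1 n := by
    intro n hn
    cases n with
    | zero => simp only [coeff_zero_extendSeries_step]; exact Submodule.zero_mem _
    | succ n =>
      simp only [coeff_succ_extendSeries_step]
      simpa using map_mem_forestSpan a (P.trU.flip (UniversalEnvelopingAlgebra.ι k f))
        (hexp n (by omega)) 1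
  have had : ∀ j, ∀ n ≤ p, (fun i => coeff n (adIter (x i) j
      (extendSeries P.trU (expSeries (x i)) (stepSeries k f)))) ∈ forestSpan a 𝓤 1 n := by
    intro j
    induction j with
    | zero => exact hV
    | succ j ih =>
      intro n hn
      simp only [adIter_succ, map_sub]
      have h1 := coeff_mul_mem_forestSpan a hx ih n hn
      have h2 := coeff_mul_mem_forestSpan a ih hx n hn
      rw [zero_add] at h1
      exact Submodule.sub_mem _ h1 h2
  intro n hn
  have hle : ∀ i : Option (Fin s), (n : ℕ∞) ≤ jointTrunc N i + 1 := by
    intro i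
    cases i with
    | none => simp [jointTrunc]
    | some i => exact le_trans (by exact_mod_cast hn) hN
  have e : (fun i => coeff n (P.stageMap (jointTrunc N i) f (x i))) =
      ∑ j ∈ range n, ((bernoulli' j : k) / (j.factorial : k)) • fun i => coeff n (adIter (x i) j
        (extendSeries P.trU (expSeries (x i)) (stepSeries k f))) := by
    funext i
    rw [stageMap, coeff_dexpInv_of_le (hx0 i) (coeff_zero_extendSeries_step _ _ f) (hle i),
      Finset.sum_apply]
    rfl
  rw [e]
  exact Submodule.sum_mem _ fun j _ => Submodule.smul_mem _ _ (had j n hn)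

open ButcherTree in
/-- The solution of the joint system is a B-series up to degree `p`. -/
theorem coeff_mem_forestSpan_of_jointMap_eq {p : ℕ} {N : ℕ∞} (hN : (p : ℕ∞) ≤ N + 1) (f : L)
    {x : Option (Fin s) → 𝓤⟦X⟧} (hx : P.jointMap a N f x = x) {n : ℕ} (hn : n ≤ p) :
    (fun i => coeff n (x i)) ∈ forestSpan a 𝓤 0 n := by
  refine ((P.isContraction_jointMap a N f).fixedPoint_induction
    (fun n v => (n = 0 → v = 0) ∧ (n ≤ p → v ∈ forestSpan a 𝓤 0 n))
    (fun n => ⟨fun _ => rfl, fun _ => Submodule.zero_mem _⟩) ?_ hx n).2 hn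
  intro x hx n
  refine ⟨?_, fun hn => ?_⟩
  · rintro rfl
    funext i
    exact P.coeff_zero_jointMap a N f x i
  · refine graft_mem_forestSpan a (P.coeff_stageMap_mem_forestSpan a hN f
      (fun i => congrFun ((hx 0).1 rfl) i) (fun n => (hx n).2) n hn) (fun i => ?_) ?_
    · rw [jointMap, coeff_sum_smul]
      rfl
    · rw [jointMap, coeff_mk]
      rfl

/-- The exact solution of the joint system is the logarithm of `exp*(h f)`. -/
theorem expSeries_eq_expStarSeries [CharZero k] (f : L) {u : 𝓤⟦X⟧}
    (hu : (PowerSeries.mk fun n => (n : k)⁻¹ • coeff n (P.stageMap ⊤ f u)) = u) :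
    expSeries u = P.expStarSeries (stepSeries k f) := by
  have hu0 : coeff 0 u = 0 := by rw [← hu, coeff_mk, coeff_zero_stageMap, smul_zero]
  have heuler : euler u = P.stageMap ⊤ f u := by
    ext n
    rw [coeff_euler]
    rcases Nat.eq_zero_or_pos n with rfl | hn
    · rw [zero_smul, coeff_zero_stageMap]
    · conv_lhs => rw [← hu]
      rw [coeff_mk, ← Nat.cast_smul_eq_nsmul k, smul_inv_smul₀ (by exact_mod_cast hn.ne')]
  exact P.eq_expStarSeries_of_euler_eq f (coeff_zero_expSeries u) (euler_expSeries hu0 heuler)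

/-- `∑ᵢ bᵢ Kᵢ` agrees with `u = log exp*(h f)` up to degree `p`, hence so do the exponentials. -/
theorem X_pow_dvd_rkmkOutput_sub [CharZero k] {p : ℕ} {N : ℕ∞} (hN : (p : ℕ∞) ≤ N + 1) (f : L)
    {b : Fin s → k} (hab : ButcherOrderConditions a b p) {K : Fin s → 𝓤⟦X⟧}
    (hK : P.IsRKMKStages N a (stepSeries k f) K) :
    (X : 𝓤⟦X⟧) ^ (p + 1) ∣ rkmkOutput b K - P.expStarSeries (stepSeries k f) := by
  obtain ⟨x, hx, -⟩ := (P.isContraction_jointMap a N f).existsUnique_fixedPoint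
  have hxsome : ∀ i, x (some i) = ∑ j, a i j • P.stageMap N f (x (some j)) := fun i =>
    (congrFun hx (some i)).symm
  have hxnone := congrFun hx none
  -- The stages are the derivatives in the joint system, by uniqueness.
  obtain rfl : K = fun i => P.stageMap N f (x (some i)) := by
    refine (P.existsUnique_isRKMKStages a N f).unique hK ((P.isRKMKStages_iff a N f _).2 ?_)
    funext i
    rw [← hxsome i]
  have hx0 : ∀ i, coeff 0 (x i) = 0 := fun i => by rw [← hx, coeff_zero_jointMap]
  rw [← P.expSeries_eq_expStarSeries f (u := x none) hxnone, X_pow_dvd_iff]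
  intro m hm
  rw [map_sub, sub_eq_zero, rkmkOutput]
  refine coeff_expSeries_congr (fun n hn => ?_) m hm
  rw [coeff_sum_smul, ← hxnone, jointMap, coeff_mk]
  exact ButcherTree.sum_smul_eq_of_mem_forestSpan a hab (by omega)
    (P.coeff_stageMap_mem_forestSpan a hN f hx0
      (fun n hn => P.coeff_mem_forestSpan_of_jointMap_eq a hN f hx hn) n (by omega))

end PostLieAlgebra

end

theorem mainTheorem4 {k L : Type*} [Field k] [CharZero k] [LieRing L] [LieAlgebra k L]
    (P : PostLieAlgebra k L) (f : L) {s : ℕ} (a : Matrix (Fin s) (Fin s) k) (b : Fin s → k)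
    (p : ℕ) (hab : ButcherOrderConditions a b p) (N : ℕ∞) (hN : (p : ℕ∞) ≤ N + 1) :
    (∃! K : Fin s → (UniversalEnvelopingAlgebra k L)⟦X⟧,
      P.IsRKMKStages N a (PostLieAlgebra.stepSeries k f) K) ∧
    ∀ K : Fin s → (UniversalEnvelopingAlgebra k L)⟦X⟧,
      P.IsRKMKStages N a (PostLieAlgebra.stepSeries k f) K →
      (PowerSeries.X : (UniversalEnvelopingAlgebra k L)⟦X⟧) ^ (p + 1) ∣
        PostLieAlgebra.rkmkOutput b K - P.expStarSeries (PostLieAlgebra.stepSeries k f) :=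
  ⟨P.existsUnique_isRKMKStages a N f, fun _ hK => P.X_pow_dvd_rkmkOutput_sub a hN f hab hK⟩
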